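/- **Setting.** For $\theta\in\mathbb R^d$ let $\|\theta\|_0$ be the number of non-zero coordinates. Let $y=\theta_*^\top x+\xi$, where $x\sim D_X$ on $\mathbb R^d$ with $\|x\|_\infty\le R_\infty$ almost surely, and $\xi$ is independent of $x$, has mean zero and is sub-Gaussian with parameter $\sigma^2$ ($\mathbb E e^{t\xi}\le e^{\sigma^2t^2/2}$ for all $t$). Let $D$ be the law of $(x,y)$, $\ell_y(a)=(a-y)^2$, $\mathcal L(\theta)=\mathbb E_D[\ell_y(\theta^\top x)]$ and $s_*=\|\theta_*\|_0$. For $1\le s<s'\le d$ suppose that for all $\theta_1,\theta_2$ with $\|\theta_1\|_0,\|\theta_2\|_0\le s$, $$\tfrac{\mu_s}2\|\theta_1-\theta_2\|^2\le\mathcal L(\theta_1)-\mathcal L(\theta_2)-\langle\nabla\mathcal L(\theta_2),\theta_1-\theta_2\rangle\le\tfrac{L_s}2\|\theta_1-\theta_2\|^2,\qquad L_s,\mu_s>0,$$ and put $\kappa_s=L_s/\mu_s$. Let $\mathcal H_s(\theta')$ be a minimizer of $\|\theta-\theta'\|$ over $\|\theta\|_0\le s$ (ties broken in any measurable way). **Algorithm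 (Hybrid).** Start from $\widetilde\theta_0\in\mathbb R^d$, with learning rate $\eta$. For $k=1,\dots,K$: (i) *Exploration.* Set $\theta_0=\mathcal H_s(\widetilde\theta_{k-1})$. Cut $[d]$ into consecutive blocks $J_1,J_2,\dots$ of length $s'-s$ (the last one possibly shorter). For $t=1,2,3$ draw fresh examples $(x_i^{(b)},y_i^{(b)})\sim D$, $b\le B^-_{t,k}$, for each block $i$, put $g_t|_{J_i}=\frac1{B^-_{t,k}}\sum_b\ell'_{y_i^{(b)}}(\theta_{t-1}^\top x_i^{(b)})\,x_i^{(b)}|_{J_i}$ and $\theta_t=\mathcal H_s(\theta_{t-1}-\eta g_t)$. Set $\widetilde\theta_k^-=\theta_3$. (ii) *Exploitation.* Set $\theta_0=\widetilde\theta_k^-$ and $S=\mathrm{supp}(\theta_0)$. For $t=1,\dots,\widetilde T$ draw fresh examples $(x^{(b)},y^{(b)})\sim D$, $b\le B_{t,k}$, put $g_t|_S=\frac1{B_{t,k}}\sum_b\ell'_{y^{(b)}}(\theta_{t-1}^\top x^{(b)})\,x^{(b)}|_S$, $g_t|_{S^c}=0$ and $\theta_t=\theta_{t-1}-\eta g_t$.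 Set $\widetilde\theta_k=\theta_{\widetilde T}$. All examples are independent. **Theorem (Hybrid).** There are universal constants $c_\eta,c_\alpha,C_s>0$ with $c_\alpha<1$, and for every $c_T>0$ a constant $C_B>0$ depending only on $c_T$, such that the following holds in every instance of the setting with $s\ge C_s\kappa_s^2s_*$. Let $\eta=c_\eta/L_s$, $\check\alpha=c_\alpha/\kappa_s$, $\widetilde\theta_0\in\mathbb R^d$, and let $\Delta_0=\mathcal L(\mathcal H_s(\widetilde\theta_0))-\mathcal L(\theta_*)$ be the objective gap at the starting point after its initial thresholding (so $\Delta_0=\mathcal L(\widetilde\theta_0)-\mathcal L(\theta_*)$ if $\|\widetilde\theta_0\|_0\le s$); assume $\Delta_0>0$. Let $\delta\in(0,\frac13)$, $$\widetilde T=\left\lceil\frac{1}{\log((1-\check\alpha)^{-1})}\log\left(\frac{d}{c_T\kappa_s^2(s'-s)}\vee1\right)\right\rceil,\qquad B_k(T)=\kappa_s^2\frac{R_\infty^4}{L_s^2}Ts^2\ \vee\ \frac{\sigma^2}{\check\alpha(1-\check\alpha)^k\Delta_0}\,\frac{R_\infty^2}{L_s}\,\frac{Ts}{(1-\check\alpha)^T}.$$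 Then there are batch sizes $\bar B^-_{t,k}\le C_B\log\left(\frac{\kappa_sd}\delta\right)B_k(3)$ and $\bar B_{t,k}\le C_B\log\left(\frac{\kappa_sd}\delta\right)B_k(\widetilde T)$ ($t,k\ge1$) such that Hybrid, run with these or any larger batch sizes, satisfies for every integer $K\ge1$ $$P\left(\mathcal L(\widetilde\theta_K)-\mathcal L(\theta_*)\le2(1-\check\alpha)^K\Delta_0\right)\ge1-\delta.$$ If moreover $\theta_*\ne0$, $r_{\min}=\min_{j\in\mathrm{supp}(\theta_*)}|\theta_*|_j|$ and $K\ge\check k+1$, where $$\check k=\left\lceil\frac{1}{\log((1-\check\alpha)^{-1})}\log\left(\frac{4\Delta_0}{r_{\min}^2\mu_s}\right)\right\rceil\in\mathbb Z,$$ then $\mathrm{supp}(\theta_*)\subseteq\mathrm{supp}(\widetilde\theta_K)$ with probability at least $1-\delta$, and $$P\left(\mathrm{supp}(\theta_*)\subseteq\mathrm{supp}(\widetilde\theta_K)\ \text{ and }\ \mathcal L(\widetilde\theta_K)-\mathcal L(\theta_*)\le2(1-\check\alpha)^{K+\widetilde T}\Delta_0\right)\ge1-2\delta.$$ -/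

import Mathlib

open MeasureTheory ProbabilityTheory
open scoped NNReal

noncomputable section

namespace SparseHybrid

/-- `ℝ^d` with the Euclidean norm. -/
abbrev E (d : ℕ) := EuclideanSpace ℝ (Fin d)

/-- The support of a vector. -/
def supp {d : ℕ} (θ : E d) : Finset (Fin d) := Finset.univ.filter fun j => θ j ≠ 0

/-- `‖θ‖₀`, the number of non-zero coordinates. -/
def l0 {d : ℕ} (θ : E d) : ℕ := (supp θ).card

/-- The smallest magnitude of the non-zero coordinates of `θ` (meant for `θ ≠ 0`, where it is
a minimum over a non-empty finite set). -/
def rMin {d : ℕ} (θ : E d) : ℝ := sInf ((fun j => |θ j|) '' {j | θ j ≠ 0})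

/-- `H` is a version of the projection onto `s`-sparse vectors: `H θ'` attains the minimum of
`‖θ - θ'‖` over all `s`-sparse `θ`. Ties may be broken in any measurable way. -/
structure IsHardThresholding {d : ℕ} (s : ℕ) (H : E d → E d) : Prop where
  measurable : Measurable H
  sparse : ∀ θ', l0 (H θ') ≤ s
  minimal : ∀ θ' θ, l0 θ ≤ s → ‖H θ' - θ'‖ ≤ ‖θ - θ'‖

/-- The joint law of `(x, y)`, where `y = ⟨θ_*, x⟩ + ξ`, and `x ∼ DX`, `ξ ∼ N` are
independent. -/
def modelLaw {d : ℕ} (DX : Measure (E d)) (N : Measure ℝ) (θs : E d) : Measure (E d × ℝ) :=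
  (DX.prod N).map fun p => (p.1, inner ℝ θs p.1 + p.2)

/-- The squared loss `ℓ_y(a) = (a - y)²`. -/
def loss (y a : ℝ) : ℝ := (a - y) ^ 2

/-- The derivative `ℓ_y'(a) = 2 (a - y)` of the squared loss. -/
def lossDeriv (y a : ℝ) : ℝ := 2 * (a - y)

/-- The expected risk `𝓛(θ) = 𝔼_{(x, y) ∼ D} ℓ_y(⟨θ, x⟩)`. -/
def risk {d : ℕ} (D : Measure (E d × ℝ)) (θ : E d) : ℝ :=
  ∫ z, loss z.2 (inner ℝ θ z.1) ∂D

/-- Restricted smoothness of `f` at sparsity level `s` with constant `L`. -/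
def RestrictedSmooth {d : ℕ} (f : E d → ℝ) (s : ℕ) (L : ℝ) : Prop :=
  ∀ θ₁ θ₂ : E d, l0 θ₁ ≤ s → l0 θ₂ ≤ s →
    f θ₁ ≤ f θ₂ + inner ℝ (gradient f θ₂) (θ₁ - θ₂) + L / 2 * ‖θ₁ - θ₂‖ ^ 2

/-- Restricted strong convexity of `f` at sparsity level `s` with constant `μ`. -/
def RestrictedStronglyConvex {d : ℕ} (f : E d → ℝ) (s : ℕ) (μ : ℝ) : Prop :=
  ∀ θ₁ θ₂ : E d, l0 θ₁ ≤ s → l0 θ₂ ≤ s →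
    f θ₂ + inner ℝ (gradient f θ₂) (θ₁ - θ₂) + μ / 2 * ‖θ₁ - θ₂‖ ^ 2 ≤ f θ₁

/-- `⟨θ|_S, x|_S⟩`: only the attributes of `x` in `S` are used. -/
def dotOn {d : ℕ} (S : Finset (Fin d)) (θ x : E d) : ℝ := ∑ j ∈ S, θ j * x j

/-- The exploration gradient estimator with batch size `B`. The coordinates are cut into the
consecutive blocks `{j | j / m = i}`, `i = 0, 1, …` of length `m` (the last one possibly
shorter), and `z i b` is the `b`-th example of block `i`. Of the example `z i b` only the
attributes in block `i` and in the support of `θ` are used. -/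
def explorationGrad {d : ℕ} (m B : ℕ) (z : ℕ → ℕ → E d × ℝ) (θ : E d) : E d :=
  WithLp.toLp 2 fun j =>
    (1 / (B : ℝ)) * ∑ b ∈ Finset.range B,
      lossDeriv (z ((j : ℕ) / m) b).2 (dotOn (supp θ) θ (z ((j : ℕ) / m) b).1) * (z ((j : ℕ) / m) b).1 j

/-- Exploration: the iterate after `t` steps, with hard thresholding operator `H`, learning rate
`η`, block length `m`, batch sizes `B 1, B 2, …`, and examples `z t i b` in step `t`. -/
def exploration {d : ℕ} (H : E d → E d) (η : ℝ) (m : ℕ) (B : ℕ → ℕ)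
    (z : ℕ → ℕ → ℕ → E d × ℝ) (θ₀ : E d) : ℕ → E d
  | 0 => H θ₀
  | t + 1 =>
    H (exploration H η m B z θ₀ t -
      η • explorationGrad m (B (t + 1)) (z (t + 1)) (exploration H η m B z θ₀ t))

/-- The exploitation gradient estimator on the coordinates in `S`, zero elsewhere. -/
def exploitationGrad {d : ℕ} (S : Finset (Fin d)) (B : ℕ) (z : ℕ → E d × ℝ) (θ : E d) : E d :=
  WithLp.toLp 2 fun j =>
    if j ∈ S then
      (1 / (B : ℝ)) * ∑ b ∈ Finset.range B,
        lossDeriv (z b).2 (dotOn S θ (z b).1) * (z b).1 j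
    else 0

/-- Exploitation: the iterate after `t` steps, with learning rate `η`, batch sizes
`B 1, B 2, …`, and examples `z t b` in step `t`. -/
def exploitation {d : ℕ} (η : ℝ) (B : ℕ → ℕ) (z : ℕ → ℕ → E d × ℝ) (θ₀ : E d) : ℕ → E d
  | 0 => θ₀
  | t + 1 =>
    exploitation η B z θ₀ t -
      η • exploitationGrad (supp θ₀) (B (t + 1)) (z (t + 1)) (exploitation η B z θ₀ t)

/-- Labels of the examples drawn by the hybrid algorithm: outer round `k`, inner step `t`,
block `i` (in exploration only), position `b` in the batch. -/
inductive SampleIdx where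
  | explore (k t i b : ℕ)
  | exploit (k t b : ℕ)

/-- Hybrid: the iterate after `k` outer rounds. Round `k` runs `Tm k` steps of exploration with
batch sizes `Bm t k`, and then `T k` steps of exploitation with batch sizes `B t k`. -/
def hybrid {d : ℕ} (H : E d → E d) (η : ℝ) (s' s : ℕ) (Bm B : ℕ → ℕ → ℕ) (Tm T : ℕ → ℕ)
    (z : SampleIdx → E d × ℝ) (θ₀ : E d) : ℕ → E d
  | 0 => θ₀
  | k + 1 =>
    exploitation η (fun t => B t (k + 1)) (fun t b => z (.exploit (k + 1) t b))
      (exploration H η (s' - s) (fun t => Bm t (k + 1))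
        (fun t i b => z (.explore (k + 1) t i b))
        (hybrid H η s' s Bm B Tm T z θ₀ k) (Tm (k + 1)))
      (T (k + 1))

/-- The batch size scale `B_k(T, s, α)`, where `gap` is the initial objective gap:
`κ² (R⁴ / L²) T s² ∨ σ² / (α (1 - α)^k gap) · (R² / L) · T s / (1 - α)^T` with `κ = L / μ`. -/
def batchScale (L μ R σ gap α : ℝ) (s k T : ℕ) : ℝ :=
  max ((L / μ) ^ 2 * (R ^ 4 / L ^ 2) * T * (s : ℝ) ^ 2)
    (σ ^ 2 / (α * (1 - α) ^ k * gap) * (R ^ 2 / L) * (T * s / (1 - α) ^ T))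

/-- The number of exploitation steps
`⌈log (d / (ω (s' - s)) ∨ 1) / log ((1 - α)⁻¹)⌉`. -/
def exploitSteps (α ω : ℝ) (d s' s : ℕ) : ℕ :=
  ⌈1 / Real.log (1 - α)⁻¹ * Real.log (max (d / (ω * ((s' : ℝ) - s))) 1)⌉₊

/-- The number of rounds `⌈log (4 gap / (r² μ)) / log ((1 - α)⁻¹)⌉` (an integer, possibly
negative). -/
def identRounds (α gap r μ : ℝ) : ℤ :=
  ⌈1 / Real.log (1 - α)⁻¹ * Real.log (4 * gap / (r ^ 2 * μ))⌉

end SparseHybrid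

end

open SparseHybrid

/-! Since the noise is centred and independent of `x`, the excess risk at `θ` is the quadratic form
`⟨G v, v⟩` with `v = θ - θ_*` and `G` the second moment operator (`risk_eq`). The restricted
inequalities at level `s` place this form between `μ/2 ‖v‖²` and `L/2 ‖v‖²` for every `2s`-sparse
`v` (`restrictedForm_covOp`). Write `κ = L/μ`.

Suppose each coordinate of a stochastic gradient has squared error at most `W`. A thresholded step
multiplies the excess by `1 - 1/(8κ)`, up to an additive `3sW/L` (`form_hardThresholding_le`): the
descent beats the price of discarding coordinates because `s ≥ 96 κ² ‖θ_*‖₀`. A step on a fixed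
support of at most `s` coordinates never increases the excess beyond a noise term
(`form_sub_smul_le`), and by a Polyak–Łojasiewicz inequality it contracts by `1 - 1/(2κ)` once the
support contains that of `θ_*`.

The error of a batch of size `B` is sub-Gaussian, with proxy variance `1/B` times an affine function
of the current excess. Everything is measured in one `L^p` norm with `p` of order `log(κd/δ)`. Then
`d ≤ e^p`, so the maximum over the coordinates costs only a factor `e`
(`eLpNorm_le_of_error_moments`), and freshness of the batch lets the moment bound at a fixed
parameter be integrated over the random iterate. Each step thus becomes a linear recursion `u ↦ (a +
r₁) u + r₂` for the `L^p` norm of the excess (`eLpNorm_form_step_le`). No events are intersected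
along the run: Markov's inequality is applied only at the end, where it gives the factor `2` and
failure probability `2^{-p} ≤ δ`, whatever the number of rounds.

With `α = 1/(64κ)`, exploration lowers the bound by the factor `1 - 6α`, and exploitation on a
possibly wrong support gives back at most `α`; so a round gains at least `1 - α` (`hybrid_round`).

A missed coordinate of `θ_*` forces an excess of at least `μ/2 · r_min²`, so a small excess
identifies the support. For the accelerated bound, the last exploitation is compared with one that
starts at `θ_*` wherever exploration failed to find the support. This modified run satisfies the
support inclusion surely, hence contracts by a further `(1 - α)^T` in `L^p`, and it agrees with the
true run off an event of probability at most `δ`. -/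

namespace SparseHybrid

/-! ### Averaging over subsets, and sparse vectors -/

/-- Among the `r`-element subsets of `A` there is one on which `f` is at most average. -/
lemma exists_subset_card_mul_sum_le {ι : Type*} [DecidableEq ι] (f : ι → ℝ) (A : Finset ι) (r : ℕ)
    (hr : r ≤ A.card) :
    ∃ R ⊆ A, R.card = r ∧ (A.card : ℝ) * ∑ j ∈ R, f j ≤ r * ∑ j ∈ A, f j := by
  induction hn : A.card generalizing A with
  | zero =>
    refine ⟨∅, by simp, by simp; omega, ?_⟩
    have : r = 0 := by omega
    simp [this]
  | succ n ih =>
    rcases hr.eq_or_lt with h | h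
    · exact ⟨A, subset_rfl, h.symm, by rw [h, hn]⟩
    -- Discard an element where `f` is largest: its value dominates the average over the subset
    -- chosen from the rest.
    · obtain ⟨a, ha, hmax⟩ := A.exists_max_image f (Finset.card_pos.1 (by omega))
      have hc : (A.erase a).card = n := by rw [Finset.card_erase_of_mem ha]; omega
      obtain ⟨R, hRA, hRc, hR⟩ := ih (A.erase a) (by omega) hc
      refine ⟨R, hRA.trans (Finset.erase_subset _ _), hRc, ?_⟩
      have h1 : ∑ j ∈ R, f j ≤ r * f a := by
        rw [← hRc, ← nsmul_eq_mul]
        exact Finset.sum_le_card_nsmul _ _ _ fun j hj => hmax j (Finset.mem_of_mem_erase (hRA hj))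
      rw [← Finset.add_sum_erase A f ha]
      push_cast
      nlinarith

section Euclidean

variable {d : ℕ}

lemma inner_eq_sum (v w : E d) : inner ℝ v w = ∑ j, v j * w j := by
  simp [PiLp.inner_apply, mul_comm]

lemma norm_sq_eq_sum (v : E d) : ‖v‖ ^ 2 = ∑ j, v j ^ 2 := EuclideanSpace.real_norm_sq_eq v

lemma mem_supp {v : E d} {j : Fin d} : j ∈ supp v ↔ v j ≠ 0 := by simp [supp]

lemma eq_zero_of_notMem {v : E d} {S : Finset (Fin d)} (h : supp v ⊆ S) {j : Fin d} (hj : j ∉ S) :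
    v j = 0 := by
  by_contra hv
  exact hj (h (mem_supp.2 hv))

lemma supp_sub_subset (v w : E d) : supp (v - w) ⊆ supp v ∪ supp w := by
  intro j
  simp only [Finset.mem_union, mem_supp, PiLp.sub_apply]
  contrapose!
  rintro ⟨h1, h2⟩
  simp [h1, h2]

lemma l0_sub_le (v w : E d) : l0 (v - w) ≤ l0 v + l0 w :=
  (Finset.card_le_card (supp_sub_subset v w)).trans (Finset.card_union_le _ _)

lemma sum_eq_sum_of_supp_subset {v : E d} {S : Finset (Fin d)} (h : supp v ⊆ S) (f : Fin d → ℝ) :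
    ∑ j, f j * v j = ∑ j ∈ S, f j * v j :=
  (Finset.sum_subset (Finset.subset_univ S) fun j _ hj => by simp [eq_zero_of_notMem h hj]).symm

lemma inner_eq_sum_of_supp_subset {v : E d} {S : Finset (Fin d)} (h : supp v ⊆ S) (w : E d) :
    inner ℝ w v = ∑ j ∈ S, w j * v j := by
  rw [inner_eq_sum, sum_eq_sum_of_supp_subset h]

lemma sum_sq_le_norm_sq (S : Finset (Fin d)) (v : E d) : ∑ j ∈ S, v j ^ 2 ≤ ‖v‖ ^ 2 := by
  rw [norm_sq_eq_sum]
  exact Finset.sum_le_sum_of_subset_of_nonneg (Finset.subset_univ S) fun _ _ _ => sq_nonneg _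

/-- The Peter–Paul inequality on the support of `v`. -/
lemma neg_inner_le_of_sq_le {e v : E d} {n : ℕ} {W c : ℝ} (hc : 0 < c) (hv : l0 v ≤ n)
    (hW : ∀ j, e j ^ 2 ≤ W) (hW0 : 0 ≤ W) :
    -inner ℝ e v ≤ c * ‖v‖ ^ 2 + n * W / (4 * c) := by
  rw [inner_eq_sum_of_supp_subset (subset_rfl : supp v ⊆ supp v)]
  have h1 : -∑ j ∈ supp v, e j * v j ≤ ∑ j ∈ supp v, (c * v j ^ 2 + W / (4 * c)) := by
    rw [← Finset.sum_neg_distrib]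
    refine Finset.sum_le_sum fun j _ => ?_
    have h2 : -(e j * v j) ≤ c * v j ^ 2 + e j ^ 2 / (4 * c) := by
      have : c * v j ^ 2 + e j ^ 2 / (4 * c) + e j * v j = (2 * c * v j + e j) ^ 2 / (4 * c) := by
        field_simp; ring
      have h3 : 0 ≤ (2 * c * v j + e j) ^ 2 / (4 * c) := by positivity
      linarith
    have h4 : e j ^ 2 / (4 * c) ≤ W / (4 * c) := by gcongr; exact hW j
    linarith
  rw [Finset.sum_add_distrib, ← Finset.mul_sum, Finset.sum_const, nsmul_eq_mul] at h1
  have h5 : c * ∑ j ∈ supp v, v j ^ 2 ≤ c * ‖v‖ ^ 2 := by gcongr; exact sum_sq_le_norm_sq _ _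
  have h6 : ((supp v).card : ℝ) * (W / (4 * c)) ≤ n * W / (4 * c) := by
    rw [← mul_div_assoc]; gcongr; exact_mod_cast hv
  linarith

end Euclidean

/-! ### Deterministic descent steps with inexact gradients -/

/-- The quadratic form of the symmetric positive operator `G` lies between `μ / 2 ‖v‖²` and
`L / 2 ‖v‖²` on `2 s`-sparse vectors `v`. -/
structure RestrictedForm {d : ℕ} (G : E d →ₗ[ℝ] E d) (s : ℕ) (L μ : ℝ) : Prop where
  symm : ∀ v w, inner ℝ (G v) w = inner ℝ (G w) v
  nonneg : ∀ v, 0 ≤ inner ℝ (G v) v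
  lower : ∀ v, l0 v ≤ 2 * s → μ / 2 * ‖v‖ ^ 2 ≤ inner ℝ (G v) v
  upper : ∀ v, l0 v ≤ 2 * s → inner ℝ (G v) v ≤ L / 2 * ‖v‖ ^ 2

namespace RestrictedForm

variable {d s : ℕ} {G : E d →ₗ[ℝ] E d} {L μ : ℝ}

lemma form_add (h : RestrictedForm G s L μ) (v w : E d) :
    inner ℝ (G (v + w)) (v + w) =
      inner ℝ (G v) v + 2 * inner ℝ (G v) w + inner ℝ (G w) w := by
  rw [map_add, inner_add_left, inner_add_right, inner_add_right, h.symm w v]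
  ring

/-- One step of gradient descent on the coordinates in `S`, with an inexact gradient. -/
lemma form_sub_smul_le (h : RestrictedForm G s L μ) {S : Finset (Fin d)} (hS : S.card ≤ s)
    (v e g : E d) {η : ℝ} (hη : 0 ≤ η) (hηL : η * L ≤ 1)
    (hg : ∀ j, g j = if j ∈ S then 2 * G v j + e j else 0) :
    inner ℝ (G (v - η • g)) (v - η • g) ≤
      inner ℝ (G v) v - η / 2 * ∑ j ∈ S, (2 * G v j) ^ 2 + η / 2 * ∑ j ∈ S, e j ^ 2 := by
  have hsupp : supp g ⊆ S := by
    intro j hj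
    by_contra hjS
    exact mem_supp.1 hj (by rw [hg, if_neg hjS])
  have h1 : inner ℝ (G v) g = ∑ j ∈ S, G v j * (2 * G v j + e j) := by
    rw [inner_eq_sum_of_supp_subset hsupp]
    exact Finset.sum_congr rfl fun j hj => by rw [hg, if_pos hj]
  have h2 : ‖g‖ ^ 2 = ∑ j ∈ S, (2 * G v j + e j) ^ 2 := by
    rw [← real_inner_self_eq_norm_sq, inner_eq_sum_of_supp_subset hsupp]
    exact Finset.sum_congr rfl fun j hj => by rw [hg, if_pos hj]; ring
  have h3 : inner ℝ (G g) g ≤ L / 2 * ‖g‖ ^ 2 := h.upper g <| by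
    have := Finset.card_le_card hsupp
    simp only [l0]; omega
  have h4 : inner ℝ (G (v - η • g)) (v - η • g) =
      inner ℝ (G v) v - 2 * η * inner ℝ (G v) g + η ^ 2 * inner ℝ (G g) g := by
    rw [sub_eq_add_neg, ← neg_smul, h.form_add, map_smul, inner_smul_left, inner_smul_right,
      inner_smul_right]
    simp; ring
  have h5 : η ^ 2 * inner ℝ (G g) g ≤ η / 2 * ‖g‖ ^ 2 := by
    calc η ^ 2 * inner ℝ (G g) g ≤ η ^ 2 * (L / 2 * ‖g‖ ^ 2) := by gcongr
      _ = (η * L) * (η / 2 * ‖g‖ ^ 2) := by ring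
      _ ≤ 1 * (η / 2 * ‖g‖ ^ 2) := by gcongr
      _ = _ := one_mul _
  -- With `a = 2 G v`, the cross term cancels: `-η a (a + e) + η/2 (a + e)² = η/2 (e² - a²)`.
  have h6 : -(2 * η) * ∑ j ∈ S, G v j * (2 * G v j + e j)
      + η / 2 * ∑ j ∈ S, (2 * G v j + e j) ^ 2 =
      - (η / 2 * ∑ j ∈ S, (2 * G v j) ^ 2) + η / 2 * ∑ j ∈ S, e j ^ 2 := by
    simp only [Finset.mul_sum, ← Finset.sum_neg_distrib, ← Finset.sum_add_distrib]
    exact Finset.sum_congr rfl fun j _ => by ring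
  rw [h1] at h4
  rw [h2] at h5
  linarith

/-- The gradient is controlled by the form. -/
lemma sum_sq_le (h : RestrictedForm G s L μ) (hL : 0 < L) {S : Finset (Fin d)} (hS : S.card ≤ s)
    (v : E d) : ∑ j ∈ S, (2 * G v j) ^ 2 ≤ 2 * L * inner ℝ (G v) v := by
  -- An exact gradient step of length `1/L` leads to a point where the form is still nonnegative, so
  -- the decrease cannot exceed the initial value.
  have h1 := h.form_sub_smul_le hS v 0 (WithLp.toLp 2 fun j => if j ∈ S then 2 * G v j else 0)
    (η := 1 / L) (by positivity) (by field_simp; rfl) (by simp)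
  have h2 := (h.nonneg _).trans h1
  simp only [PiLp.zero_apply, ne_eq, OfNat.ofNat_ne_zero, not_false_eq_true, zero_pow,
    Finset.sum_const_zero, mul_zero, add_zero] at h2
  have h3 : 1 / L / 2 * ∑ j ∈ S, (2 * G v j) ^ 2 ≤ inner ℝ (G v) v := by linarith
  have h4 : 1 / L / 2 * ∑ j ∈ S, (2 * G v j) ^ 2 = (∑ j ∈ S, (2 * G v j) ^ 2) / (2 * L) := by
    field_simp
  rw [h4, div_le_iff₀ (by positivity)] at h3
  linarith

/-- The Polyak–Łojasiewicz inequality for vectors supported in `S`. -/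
lemma le_sum_sq (h : RestrictedForm G s L μ) (hμ : 0 < μ) {S : Finset (Fin d)} (hS : S.card ≤ s)
    {v : E d} (hv : supp v ⊆ S) : 2 * μ * inner ℝ (G v) v ≤ ∑ j ∈ S, (2 * G v j) ^ 2 := by
  have h1 := h.lower v (by have := Finset.card_le_card hv; simp only [l0]; omega)
  have h2 : ‖v‖ ^ 2 = ∑ j ∈ S, v j ^ 2 := by
    rw [← real_inner_self_eq_norm_sq, inner_eq_sum_of_supp_subset hv]
    exact Finset.sum_congr rfl fun j _ => by ring
  -- Expanding the square bounds the squared gradient below by `4μ ⟨G v, v⟩ - μ² ‖v‖²`, and strong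
  -- convexity absorbs half of the first term.
  have h3 : 0 ≤ ∑ j ∈ S, (2 * G v j - μ * v j) ^ 2 := Finset.sum_nonneg fun _ _ => sq_nonneg _
  have h4 : ∑ j ∈ S, (2 * G v j - μ * v j) ^ 2 =
      ∑ j ∈ S, (2 * G v j) ^ 2 - 4 * μ * ∑ j ∈ S, G v j * v j + μ ^ 2 * ∑ j ∈ S, v j ^ 2 := by
    simp only [Finset.mul_sum, ← Finset.sum_sub_distrib, ← Finset.sum_add_distrib]
    exact Finset.sum_congr rfl fun j _ => by ring
  rw [inner_eq_sum_of_supp_subset hv (G v)] at h1 ⊢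
  rw [h2] at h1
  nlinarith

/-- One step of inexact gradient descent contracts when the minimizer is supported in `S`. -/
lemma form_sub_smul_le_of_supp_subset (h : RestrictedForm G s L μ) (hμ : 0 < μ)
    {S : Finset (Fin d)} (hS : S.card ≤ s)
    {v : E d} (hv : supp v ⊆ S) (e g : E d) {η : ℝ} (hη : 0 ≤ η) (hηL : η * L ≤ 1)
    (hg : ∀ j, g j = if j ∈ S then 2 * G v j + e j else 0) :
    inner ℝ (G (v - η • g)) (v - η • g) ≤
      (1 - η * μ) * inner ℝ (G v) v + η / 2 * ∑ j ∈ S, e j ^ 2 := by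
  have h1 := h.form_sub_smul_le hS v e g hη hηL hg
  have h2 := mul_le_mul_of_nonneg_left (h.le_sum_sq hμ hS hv) (by positivity : 0 ≤ η / 2)
  linarith

/-- One step of inexact iterative hard thresholding. -/
lemma form_hardThresholding_le (h : RestrictedForm G s L μ) (hL : 0 < L) (hμ : 0 < μ)
    (hμL : μ ≤ L) {θ u e z θ' : E d} {W : ℝ} (hs : 96 * (L / μ) ^ 2 * l0 u ≤ s) (hs1 : 1 ≤ s)
    (hθ : l0 θ ≤ s) (hθ' : l0 θ' ≤ s)
    (hz : ∀ j, z j = θ j - 1 / (2 * L) * (2 * G (θ - u) j + e j))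
    (hmin : ∀ w, l0 w ≤ s → ‖θ' - z‖ ≤ ‖w - z‖) (hW : ∀ j, e j ^ 2 ≤ W) (hW0 : 0 ≤ W) :
    inner ℝ (G (θ' - u)) (θ' - u) ≤
      (1 - 1 / (8 * (L / μ))) * inner ℝ (G (θ - u)) (θ - u) + 3 * s / L * W := by
  set κ := L / μ with hκ
  have hκ1 : 1 ≤ κ := by rw [hκ, le_div_iff₀ hμ]; linarith
  set v := θ - u with hv
  set q := inner ℝ (G v) v with hq
  have hu : 96 * l0 u ≤ s := by
    have : (96 * l0 u : ℝ) ≤ s := le_trans (by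
      nlinarith [(Nat.cast_nonneg (l0 u) : (0 : ℝ) ≤ l0 u), one_le_pow₀ hκ1 (n := 2)]) hs
    exact_mod_cast this
  have hv0 : l0 v ≤ 2 * s := (l0_sub_le θ u).trans (by omega)
  have hlow := h.lower v hv0
  -- the comparison point
  set lam := μ / (4 * L) with hlam
  have hlam0 : 0 < lam := by positivity
  -- The point `θ - lam • v` lies between `θ` and `u` but may have too many coordinates. At most `l0
  -- u` of them must go; they are chosen among at least `s/2` coordinates outside `supp u`, where
  -- `z²` is at most average. The cost is a fraction `2 l0 u / s ≤ 1/(48κ²)` of the sum of `z²`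
  -- there, which is where the constant `96` comes from.
  obtain ⟨w, hw, hwz⟩ : ∃ w : E d, l0 w ≤ s ∧
      ‖w - z‖ ^ 2 ≤ ‖θ - lam • v - z‖ ^ 2 + 1 / (48 * κ ^ 2) * ∑ j ∈ supp θ \ supp u, z j ^ 2 := by
    have hsu : supp (θ - lam • v) ⊆ supp θ ∪ supp u := by
      intro j
      simp only [Finset.mem_union, mem_supp, PiLp.sub_apply, PiLp.smul_apply, hv, smul_eq_mul]
      contrapose!
      rintro ⟨h1, h2⟩
      simp [h1, h2]
    have hnn : 0 ≤ 1 / (48 * κ ^ 2) * ∑ j ∈ supp θ \ supp u, z j ^ 2 :=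
      mul_nonneg (by positivity) (Finset.sum_nonneg fun _ _ => sq_nonneg _)
    by_cases hc : (supp θ ∪ supp u).card ≤ s
    · exact ⟨_, (Finset.card_le_card hsu).trans hc, by linarith⟩
    have hcard : (supp θ \ supp u).card + l0 u = (supp θ ∪ supp u).card := by
      rw [l0, Finset.card_sdiff_add_card]
    have hcard2 := Finset.card_union_le (supp θ) (supp u)
    simp only [l0] at hθ hu hcard
    obtain ⟨T, hT, hTc, hTs⟩ := exists_subset_card_mul_sum_le (fun j => z j ^ 2)
      (supp θ \ supp u) ((supp θ ∪ supp u).card - s) (by omega)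
    refine ⟨WithLp.toLp 2 fun j => if j ∈ T then 0 else (θ - lam • v) j, ?_, ?_⟩
    · have h1 : supp (WithLp.toLp 2 fun j => if j ∈ T then 0 else (θ - lam • v) j) ⊆
          (supp θ ∪ supp u) \ T := by
        intro j hj
        rw [mem_supp] at hj
        by_cases hjT : j ∈ T
        · simp [hjT] at hj
        · simp only [hjT, if_false] at hj
          exact Finset.mem_sdiff.2 ⟨hsu (mem_supp.2 hj), hjT⟩
      have h2 := Finset.card_le_card h1
      have hTu : T ⊆ supp θ ∪ supp u :=
        hT.trans (Finset.sdiff_subset.trans Finset.subset_union_left)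
      rw [Finset.card_sdiff_of_subset hTu] at h2
      simp only [l0]; omega
    · have h1 : ∑ j ∈ T, z j ^ 2 ≤ 1 / (48 * κ ^ 2) * ∑ j ∈ supp θ \ supp u, z j ^ 2 := by
        set t₁ := ∑ j ∈ T, z j ^ 2
        set t₂ := ∑ j ∈ supp θ \ supp u, z j ^ 2
        have ht₂ : 0 ≤ t₂ := Finset.sum_nonneg fun _ _ => sq_nonneg _
        have ht₁ : 0 ≤ t₁ := Finset.sum_nonneg fun _ _ => sq_nonneg _
        have ha : (s : ℝ) / 2 ≤ (supp θ \ supp u).card := by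
          rw [div_le_iff₀ (by norm_num)]
          exact_mod_cast (by omega : s ≤ (supp θ \ supp u).card * 2)
        have hb : (((supp θ ∪ supp u).card - s : ℕ) : ℝ) ≤ l0 u := by
          exact_mod_cast (by simp only [l0]; omega)
        have h2 : s / 2 * t₁ ≤ l0 u * t₂ :=
          (mul_le_mul_of_nonneg_right ha ht₁).trans (hTs.trans (mul_le_mul_of_nonneg_right hb ht₂))
        have hs0 : (0 : ℝ) < s := by exact_mod_cast hs1
        have h3 : 96 * κ ^ 2 * (l0 u * t₂) ≤ s * t₂ := by
          rw [← mul_assoc]; exact mul_le_mul_of_nonneg_right hs ht₂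
        rw [div_mul_eq_mul_div, one_mul, le_div_iff₀ (by positivity)]
        have h4 : s * (t₁ * (48 * κ ^ 2)) ≤ s * t₂ := by
          have := mul_le_mul_of_nonneg_left h2 (by positivity : 0 ≤ 96 * κ ^ 2)
          linarith
        exact le_of_mul_le_mul_left h4 hs0
      refine le_trans ?_ (add_le_add_right h1 _)
      rw [norm_sq_eq_sum, norm_sq_eq_sum,
        ← Finset.sum_filter_add_sum_filter_not Finset.univ (· ∈ T), add_comm]
      refine add_le_add ?_ (le_of_eq ?_)
      · refine le_trans (le_of_eq ?_) (Finset.sum_le_sum_of_subset_of_nonneg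
          (Finset.filter_subset (fun j => j ∉ T) _) fun _ _ _ => sq_nonneg _)
        exact Finset.sum_congr rfl fun j hj => by simp [(Finset.mem_filter.1 hj).2]
      · simp only [Finset.filter_mem_eq_inter, Finset.univ_inter]
        exact Finset.sum_congr rfl fun j hj => by simp [hj]
  -- the objective at the new point
  obtain ⟨g, hg⟩ : ∃ g : E d, g = (2 : ℝ) • G v + e := ⟨_, rfl⟩
  have hz' : z = θ - (1 / (2 * L)) • g := by
    ext j; rw [hz]; simp [hg]; ring
  set D := θ' - θ with hD
  have e1 : inner ℝ (G (θ' - u)) (θ' - u) = q + inner ℝ g D - inner ℝ e D + inner ℝ (G D) D := by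
    have : θ' - u = v + D := by rw [hv, hD]; abel
    rw [this, h.form_add, hg, inner_add_left, inner_smul_left]
    simp; ring
  have hD0 : l0 D ≤ 2 * s := (l0_sub_le _ _).trans (by omega)
  have e2 := h.upper D hD0
  -- The step length `1/(2L)` is half of what smoothness allows. This leaves a spare `L/2 ‖D‖²` to
  -- absorb the gradient error, and the total `⟨g, D⟩ + L ‖D‖²` is a squared distance to `z` up to a
  -- constant, so the minimality of `θ'` applies.
  have e3 : -inner ℝ e D ≤ L / 2 * ‖D‖ ^ 2 + s / L * W := by
    refine (neg_inner_le_of_sq_le (by positivity : 0 < L / 2) hD0 hW hW0).trans (le_of_eq ?_)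
    push_cast; field_simp; ring
  have e4 : inner ℝ g D + L * ‖D‖ ^ 2 = L * (‖θ' - z‖ ^ 2 - ‖(1 / (2 * L)) • g‖ ^ 2) := by
    have : θ' - z = D + (1 / (2 * L)) • g := by rw [hz', hD]; abel
    rw [this, norm_add_sq_real, inner_smul_right, real_inner_comm D g]
    field_simp; ring
  have e5 : L * (‖θ - lam • v - z‖ ^ 2 - ‖(1 / (2 * L)) • g‖ ^ 2) =
      - lam * inner ℝ g v + L * lam ^ 2 * ‖v‖ ^ 2 := by
    have : θ - lam • v - z = (1 / (2 * L)) • g - lam • v := by rw [hz']; abel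
    rw [this, norm_sub_sq_real, inner_smul_left, inner_smul_right, norm_smul lam v, mul_pow,
      Real.norm_eq_abs lam, sq_abs]
    simp
    field_simp; ring
  have e6 : inner ℝ g v = 2 * q + inner ℝ e v := by
    rw [hg, inner_add_left, inner_smul_left]; simp [hq]
  have e7 : -inner ℝ e v ≤ μ / 4 * ‖v‖ ^ 2 + 2 * s / μ * W := by
    refine (neg_inner_le_of_sq_le (by positivity : 0 < μ / 4) hv0 hW hW0).trans (le_of_eq ?_)
    push_cast; field_simp
  have e8 : ‖θ' - z‖ ^ 2 ≤ ‖w - z‖ ^ 2 := pow_le_pow_left₀ (norm_nonneg _) (hmin w hw) 2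
  -- Outside `supp u` the entry `z j` involves only `v j` and the gradient, both controlled by the
  -- excess `q`. This is why only coordinates outside `supp u` are discarded.
  have e9 : ∑ j ∈ supp θ \ supp u, z j ^ 2 ≤ 6 * q / μ + s / L ^ 2 * W := by
    have c1 : ∑ j ∈ supp θ \ supp u, z j ^ 2 ≤
        ∑ j ∈ supp θ, (2 * v j ^ 2 + 1 / L ^ 2 * (2 * G v j) ^ 2 + 1 / L ^ 2 * W) := by
      refine (Finset.sum_le_sum (g := fun j =>
        2 * v j ^ 2 + 1 / L ^ 2 * (2 * G v j) ^ 2 + 1 / L ^ 2 * W) fun j hj => ?_).trans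
        (Finset.sum_le_sum_of_subset_of_nonneg Finset.sdiff_subset fun _ _ _ => by positivity)
      have hju : u j = 0 := by
        by_contra hne
        exact (Finset.mem_sdiff.1 hj).2 (mem_supp.2 hne)
      have c2 : z j = v j - 1 / (2 * L) * (2 * G v j + e j) := by
        rw [hz]; simp [hv, hju]
      have c3 : 1 / L ^ 2 * e j ^ 2 ≤ 1 / L ^ 2 * W := by gcongr; exact hW j
      have c4 : 0 ≤ (v j + 1 / (2 * L) * (2 * G v j + e j)) ^ 2 := sq_nonneg _
      have c5 : 0 ≤ 1 / L ^ 2 * (2 * G v j - e j) ^ 2 := by positivity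
      have c6 : z j ^ 2 + (v j + 1 / (2 * L) * (2 * G v j + e j)) ^ 2
          = 2 * v j ^ 2 + 1 / L ^ 2 * (2 * G v j + e j) ^ 2 / 2 := by
        rw [c2]; field_simp; ring
      have c7 : 1 / L ^ 2 * (2 * G v j + e j) ^ 2 / 2 = 1 / L ^ 2 * (2 * G v j) ^ 2
          + 1 / L ^ 2 * e j ^ 2 - 1 / L ^ 2 * (2 * G v j - e j) ^ 2 / 2 := by ring
      linarith
    rw [Finset.sum_add_distrib, Finset.sum_add_distrib, ← Finset.mul_sum, ← Finset.mul_sum,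
      Finset.sum_const, nsmul_eq_mul] at c1
    have c2 := sum_sq_le_norm_sq (supp θ) v
    have c3 : 1 / L ^ 2 * ∑ j ∈ supp θ, (2 * G v j) ^ 2 ≤ 2 * q / μ := by
      calc _ ≤ 1 / L ^ 2 * (2 * L * q) := by gcongr; exact h.sum_sq_le hL hθ v
        _ = 2 * q / L := by field_simp
        _ ≤ 2 * q / μ := by
          have := h.nonneg v
          gcongr
    have c4 : ((supp θ).card : ℝ) * (1 / L ^ 2 * W) ≤ s / L ^ 2 * W := by
      calc _ ≤ (s : ℝ) * (1 / L ^ 2 * W) := by gcongr; exact_mod_cast hθ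
        _ = _ := by ring
    have c5 : 2 * ‖v‖ ^ 2 ≤ 4 * q / μ := by
      rw [le_div_iff₀ hμ]; linarith
    have c6 : 6 * q / μ = 4 * q / μ + 2 * q / μ := by ring
    linarith
  have hq0 : 0 ≤ q := h.nonneg v
  -- The budget in units of `lam * q = q/(4κ)`: the descent gains `2`, while the error along `v`,
  -- the quadratic term and the truncation cost `1/2` each. The remaining `1/2` is the rate
  -- `1/(8κ)`. The noise terms add up to `1 + 1/2 + 1 ≤ 3` times `s/L * W`.
  have f1 : L * (1 / (48 * κ ^ 2) * ∑ j ∈ supp θ \ supp u, z j ^ 2) ≤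
      1 / (8 * κ) * q + s / L * W := by
    calc _ ≤ L * (1 / (48 * κ ^ 2) * (6 * q / μ + s / L ^ 2 * W)) := by gcongr
      _ = 1 / (8 * κ) * q + 1 / (48 * κ ^ 2) * (s / L * W) := by
        rw [hκ]; field_simp; ring
      _ ≤ 1 / (8 * κ) * q + 1 * (s / L * W) := by
        gcongr
        rw [div_le_one (by positivity)]
        nlinarith
      _ = _ := by ring
  have f2 : lam * (-inner ℝ e v) ≤ lam * (μ / 4 * ‖v‖ ^ 2 + 2 * s / μ * W) := by gcongr
  have f3 : lam * (2 * s / μ * W) = 1 / 2 * (s / L * W) := by rw [hlam]; field_simp; norm_num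
  have f4 : L * lam ^ 2 * ‖v‖ ^ 2 = lam * (μ / 4 * ‖v‖ ^ 2) := by rw [hlam]; field_simp
  have f5 : lam * (μ / 4 * ‖v‖ ^ 2) ≤ lam * (q / 2) := by gcongr; linarith
  have f6 : lam * q = 2 * (1 / (8 * κ) * q) := by rw [hlam, hκ]; field_simp; ring
  have f7 : L * ‖θ' - z‖ ^ 2 ≤
      L * (‖θ - lam • v - z‖ ^ 2 + 1 / (48 * κ ^ 2) * ∑ j ∈ supp θ \ supp u, z j ^ 2) := by
    gcongr; exact e8.trans hwz
  have f8 : 3 * s / L * W = 3 * (s / L * W) := by ring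
  have f9 : 0 ≤ s / L * W := by positivity
  rw [e6] at e5
  rw [e1, f8]
  linarith

end RestrictedForm

/-! ### The second moment operator and the risk as a quadratic form -/

section Covariance

variable {d : ℕ}

/-- The second moment operator `v ↦ 𝔼 ⟨v, x⟩ x`. -/
noncomputable def covOp (DX : Measure (E d)) : E d →ₗ[ℝ] E d where
  toFun v := WithLp.toLp 2 fun i => ∑ j, (∫ x, x i * x j ∂DX) * v j
  map_add' v w := by
    ext i; simp [mul_add, Finset.sum_add_distrib]
  map_smul' c v := by
    ext i; simp only [PiLp.smul_apply, smul_eq_mul, RingHom.id_apply, Finset.mul_sum]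
    exact Finset.sum_congr rfl fun j _ => by ring

variable {DX : Measure (E d)} [IsProbabilityMeasure DX] {R : ℝ}

lemma integrable_coord_mul (hR : ∀ᵐ x ∂DX, ∀ j, |x j| ≤ R) (i j : Fin d) :
    Integrable (fun x : E d => x i * x j) DX := by
  refine Integrable.of_bound (C := R * R) (by fun_prop) ?_
  filter_upwards [hR] with x hx
  rw [Real.norm_eq_abs, abs_mul]
  exact mul_le_mul (hx i) (hx j) (abs_nonneg _) ((abs_nonneg _).trans (hx i))

lemma covOp_apply (hR : ∀ᵐ x ∂DX, ∀ j, |x j| ≤ R) (v : E d) (i : Fin d) :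
    covOp DX v i = ∫ x, inner ℝ v x * x i ∂DX := by
  simp only [inner_eq_sum, Finset.sum_mul]
  rw [integral_finsetSum _ fun j _ => by
    simpa [mul_assoc] using (integrable_coord_mul hR j i).const_mul (v j)]
  simp only [covOp, LinearMap.coe_mk, AddHom.coe_mk]
  refine Finset.sum_congr rfl fun j _ => ?_
  simp only [mul_assoc]
  rw [integral_const_mul, mul_comm]
  simp only [mul_comm]

lemma integrable_inner_mul (hR : ∀ᵐ x ∂DX, ∀ j, |x j| ≤ R) (v : E d) (i : Fin d) :
    Integrable (fun x : E d => inner ℝ v x * x i) DX := by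
  simp only [inner_eq_sum, Finset.sum_mul]
  exact integrable_finsetSum _ fun j _ => by
    simpa [mul_assoc] using (integrable_coord_mul hR j i).const_mul (v j)

lemma integrable_inner_mul_inner (hR : ∀ᵐ x ∂DX, ∀ j, |x j| ≤ R) (v w : E d) :
    Integrable (fun x : E d => inner ℝ v x * inner ℝ w x) DX := by
  simp only [inner_eq_sum w, Finset.mul_sum]
  exact integrable_finsetSum _ fun j _ => by
    simpa [mul_left_comm] using (integrable_inner_mul hR v j).const_mul (w j)

lemma inner_covOp (hR : ∀ᵐ x ∂DX, ∀ j, |x j| ≤ R) (v w : E d) :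
    inner ℝ (covOp DX v) w = ∫ x, inner ℝ v x * inner ℝ w x ∂DX := by
  rw [inner_eq_sum]
  simp only [inner_eq_sum w, Finset.mul_sum]
  rw [integral_finsetSum _ fun j _ => by
    simpa [mul_left_comm] using (integrable_inner_mul hR v j).const_mul (w j)]
  refine Finset.sum_congr rfl fun j _ => ?_
  rw [covOp_apply hR, ← integral_mul_const]
  exact integral_congr_ae (.of_forall fun x => by ring)

lemma abs_inner_le {s : ℕ} {v x : E d} (hv : l0 v ≤ s) (hx : ∀ j, |x j| ≤ R) (hR : 0 ≤ R) :
    |inner ℝ v x| ≤ √s * R * ‖v‖ := by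
  have h1 : inner ℝ v x = ∑ j ∈ supp v, x j * v j := by
    rw [real_inner_comm]; exact inner_eq_sum_of_supp_subset subset_rfl x
  have h2 : (∑ j ∈ supp v, x j * v j) ^ 2 ≤ (s * R ^ 2) * ‖v‖ ^ 2 := by
    refine (Finset.sum_mul_sq_le_sq_mul_sq _ _ _).trans ?_
    gcongr
    · calc ∑ j ∈ supp v, x j ^ 2 ≤ ∑ j ∈ supp v, R ^ 2 := by
            refine Finset.sum_le_sum fun j _ => ?_
            rw [← sq_abs]; exact pow_le_pow_left₀ (abs_nonneg _) (hx j) 2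
        _ = l0 v * R ^ 2 := by rw [Finset.sum_const, nsmul_eq_mul]; rfl
        _ ≤ s * R ^ 2 := by gcongr
    · exact sum_sq_le_norm_sq _ _
  rw [h1]
  refine abs_le_of_sq_le_sq (h2.trans (le_of_eq ?_)) (by positivity)
  rw [mul_pow, mul_pow, Real.sq_sqrt (by positivity)]

end Covariance

section Model

variable {d : ℕ} {DX : Measure (E d)} [IsProbabilityMeasure DX] {N : Measure ℝ}
  [IsProbabilityMeasure N] {R : ℝ} {σ : ℝ≥0}

lemma measurable_model (θs : E d) :
    Measurable fun p : E d × ℝ => (p.1, inner ℝ θs p.1 + p.2) := by fun_prop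

/-- The residual is `⟨θ - θs, x⟩ - ξ`; in its square the cross term integrates to zero because `ξ`
is centred and independent of `x`. -/
lemma risk_eq (hR : ∀ᵐ x ∂DX, ∀ j, |x j| ≤ R) (hN : ∫ ξ, ξ ∂N = 0)
    (hσ : HasSubgaussianMGF id (σ ^ 2) N) (θs θ : E d) :
    risk (modelLaw DX N θs) θ =
      inner ℝ (covOp DX (θ - θs)) (θ - θs) + ∫ ξ, ξ ^ 2 ∂N := by
  have hsq : Integrable (fun ξ : ℝ => ξ ^ 2) N := (hσ.memLp 2).integrable_sq
  have hid : Integrable (fun ξ : ℝ => ξ) N := hσ.integrable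
  have hin : Integrable (fun x : E d => inner ℝ (θ - θs) x) DX := by
    simp only [inner_eq_sum]
    refine integrable_finsetSum _ fun j _ => Integrable.const_mul ?_ _
    refine Integrable.of_bound (C := R) (by fun_prop) ?_
    filter_upwards [hR] with x hx using hx j
  rw [risk, modelLaw, integral_map (measurable_model θs).aemeasurable
    (by unfold loss; fun_prop)]
  have h1 : ∀ p : E d × ℝ, loss (inner ℝ θs p.1 + p.2) (inner ℝ θ p.1) =
      inner ℝ (θ - θs) p.1 * inner ℝ (θ - θs) p.1 - 2 * (inner ℝ (θ - θs) p.1 * p.2)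
        + p.2 ^ 2 := by
    intro p
    rw [loss, inner_sub_left]; ring
  simp only [h1]
  have i1 : Integrable (fun p : E d × ℝ => inner ℝ (θ - θs) p.1 * inner ℝ (θ - θs) p.1)
      (DX.prod N) := (integrable_inner_mul_inner hR _ _).comp_fst N
  have i2 : Integrable (fun p : E d × ℝ => 2 * (inner ℝ (θ - θs) p.1 * p.2)) (DX.prod N) :=
    (hin.mul_prod hid).const_mul 2
  have i3 : Integrable (fun p : E d × ℝ => p.2 ^ 2) (DX.prod N) := hsq.comp_snd DX
  rw [integral_add (by exact i1.sub i2) i3, integral_sub i1 i2, integral_const_mul,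
    integral_prod_mul (fun x : E d => inner ℝ (θ - θs) x) (fun ξ : ℝ => ξ), hN,
    inner_covOp hR]
  simp only [mul_zero, sub_zero]
  congr 1
  · exact integral_fun_fst (fun x : E d => inner ℝ (θ - θs) x * inner ℝ (θ - θs) x) |>.trans (by simp)
  · exact integral_fun_snd (fun ξ : ℝ => ξ ^ 2) |>.trans (by simp)

lemma covOp_symm (hR : ∀ᵐ x ∂DX, ∀ j, |x j| ≤ R) (v w : E d) :
    inner ℝ (covOp DX v) w = inner ℝ (covOp DX w) v := by
  simp only [inner_covOp hR, mul_comm]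

lemma inner_gradient_risk (hR : ∀ᵐ x ∂DX, ∀ j, |x j| ≤ R) (hN : ∫ ξ, ξ ∂N = 0)
    (hσ : HasSubgaussianMGF id (σ ^ 2) N) (θs θ w : E d) :
    inner ℝ (gradient (risk (modelLaw DX N θs)) θ) w =
      2 * inner ℝ (covOp DX (θ - θs)) w := by
  have h1 : risk (modelLaw DX N θs) = fun θ =>
      inner ℝ ((covOp DX).toContinuousLinearMap (θ - θs)) (θ - θs) + ∫ ξ, ξ ^ 2 ∂N := by
    funext θ; exact risk_eq hR hN hσ θs θ
  have h2 : HasFDerivAt (fun θ : E d => θ - θs) (ContinuousLinearMap.id ℝ (E d)) θ :=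
    (hasFDerivAt_id θ).sub_const θs
  have h3 := (((covOp DX).toContinuousLinearMap.hasFDerivAt.comp θ h2).inner ℝ h2).add_const
    (∫ ξ, ξ ^ 2 ∂N)
  rw [gradient, InnerProductSpace.toDual_symm_apply, h1]
  erw [h3.fderiv]
  simp [fderivInnerCLM_apply, covOp_symm hR w, two_mul]

/-- A `2s`-sparse vector is a difference `a - b` of two `s`-sparse vectors with disjoint supports,
and for a quadratic risk the linearization error between `a` and `b` is exactly the form at `a - b`.
Thus hypotheses at level `s` give bounds at level `2s`. -/
lemma restrictedForm_covOp (hR : ∀ᵐ x ∂DX, ∀ j, |x j| ≤ R) (hN : ∫ ξ, ξ ∂N = 0)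
    (hσ : HasSubgaussianMGF id (σ ^ 2) N) {θs : E d} {s : ℕ} {L μ : ℝ}
    (hL : RestrictedSmooth (risk (modelLaw DX N θs)) s L)
    (hμ : RestrictedStronglyConvex (risk (modelLaw DX N θs)) s μ) :
    RestrictedForm (covOp DX) s L μ := by
  have hsymm := covOp_symm (DX := DX) hR
  have key : ∀ v : E d, l0 v ≤ 2 * s →
      μ / 2 * ‖v‖ ^ 2 ≤ inner ℝ (covOp DX v) v ∧
        inner ℝ (covOp DX v) v ≤ L / 2 * ‖v‖ ^ 2 := by
    intro v hv
    obtain ⟨A, hA, hAc⟩ := Finset.exists_subset_card_eq (min_le_right s (supp v).card)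
    obtain ⟨a, ha⟩ : ∃ a : E d, a = WithLp.toLp 2 fun j => if j ∈ A then v j else 0 := ⟨_, rfl⟩
    obtain ⟨b, hb⟩ : ∃ b : E d, b = WithLp.toLp 2 fun j => if j ∈ A then 0 else -v j := ⟨_, rfl⟩
    have hab : a - b = v := by
      ext j; by_cases hj : j ∈ A <;> simp [ha, hb, hj]
    have ha0 : l0 a ≤ s := by
      have : supp a ⊆ A := by
        intro j; rw [mem_supp, ha]; simp +contextual
      have := Finset.card_le_card this
      simp only [l0]; omega
    have hb0 : l0 b ≤ s := by
      have : supp b ⊆ supp v \ A := by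
        intro j; rw [mem_supp, hb, Finset.mem_sdiff, mem_supp]
        by_cases hj : j ∈ A <;> simp [hj]
      have := Finset.card_le_card this
      rw [Finset.card_sdiff_of_subset hA] at this
      simp only [l0] at hv ⊢; omega
    have h1 := hL a b ha0 hb0
    have h2 := hμ a b ha0 hb0
    rw [inner_gradient_risk hR hN hσ, risk_eq hR hN hσ, risk_eq hR hN hσ, hab] at h1 h2
    have h3 : a - θs = (b - θs) + v := by rw [← hab]; abel
    have h4 : inner ℝ (covOp DX (a - θs)) (a - θs) = inner ℝ (covOp DX (b - θs)) (b - θs)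
        + 2 * inner ℝ (covOp DX (b - θs)) v + inner ℝ (covOp DX v) v := by
      rw [h3, map_add, inner_add_left, inner_add_right, inner_add_right, hsymm v (b - θs)]
      ring
    constructor <;> linarith
  refine ⟨hsymm, fun v => ?_, fun v hv => (key v hv).1, fun v hv => (key v hv).2⟩
  rw [inner_covOp hR]
  exact integral_nonneg fun x => mul_self_nonneg _

lemma l0_single_le (j : Fin d) : l0 (EuclideanSpace.single j (1 : ℝ)) ≤ 1 := by
  have : supp (EuclideanSpace.single j (1 : ℝ)) ⊆ {j} := by
    intro i; rw [mem_supp]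
    simp only [PiLp.single_apply, Finset.mem_singleton]
    contrapose!
    intro h; simp [h]
  exact (Finset.card_le_card this).trans (by simp)

lemma RestrictedForm.le_of_one_le {G : E d →ₗ[ℝ] E d} {s : ℕ} {L μ : ℝ}
    (h : RestrictedForm G s L μ) (hs : 1 ≤ s) (hd : 0 < d) : μ ≤ L := by
  have h0 := (l0_single_le (⟨0, hd⟩ : Fin d)).trans (by omega : 1 ≤ 2 * s)
  have := (h.lower _ h0).trans (h.upper _ h0)
  simp at this
  linarith

/-- Test the form on a basis vector. This keeps the batch size scale away from zero, so that
rounding it down is harmless. -/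
lemma RestrictedForm.le_sq_bound (hR : ∀ᵐ x ∂DX, ∀ j, |x j| ≤ R) {s : ℕ} {L μ : ℝ}
    (h : RestrictedForm (covOp DX) s L μ) (hs : 1 ≤ s) (hd : 0 < d) : μ / 2 ≤ R ^ 2 := by
  have h0 := (l0_single_le (⟨0, hd⟩ : Fin d)).trans (by omega : 1 ≤ 2 * s)
  have h1 := h.lower _ h0
  rw [inner_covOp hR] at h1
  simp only [PiLp.norm_single, norm_one, one_pow, mul_one] at h1
  refine h1.trans ?_
  have h2 : ∫ x, R ^ 2 ∂DX = R ^ 2 := by simp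
  rw [← h2]
  refine integral_mono_ae (integrable_inner_mul_inner hR _ _) (integrable_const _) ?_
  filter_upwards [hR] with x hx
  simp only [EuclideanSpace.inner_single_left, map_one, one_mul]
  rw [← sq, ← sq_abs]
  exact pow_le_pow_left₀ (abs_nonneg _) (hx _) 2

end Model

/-! ### Sub-Gaussian moments of the gradient error -/

section SubGaussian

variable {Ω : Type*} [MeasurableSpace Ω] {P : Measure Ω}

lemma hasSubgaussianMGF_mono {X : Ω → ℝ} {c c' : ℝ≥0} (h : HasSubgaussianMGF X c P)
    (hc : c ≤ c') : HasSubgaussianMGF X c' P where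
  integrable_exp_mul := h.integrable_exp_mul
  mgf_le t := (h.mgf_le t).trans (by gcongr)

lemma hasSubgaussianMGF_mul_left {X : Ω → ℝ} {c : ℝ≥0} (h : HasSubgaussianMGF X c P) (r : ℝ) :
    HasSubgaussianMGF (fun ω => r * X ω) (Real.toNNReal (r ^ 2) * c) P := by
  rw [Real.toNNReal_of_nonneg (sq_nonneg r)]
  exact h.const_mul r

/-- The even moments of a sub-Gaussian random variable. -/
lemma integral_pow_le_of_hasSubgaussianMGF {X : Ω → ℝ} {c : ℝ≥0} (h : HasSubgaussianMGF X c P)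
    {p : ℕ} (hp : 1 ≤ p) : ∫ ω, X ω ^ (2 * p) ∂P ≤ (4 * Real.exp 1 * p * c) ^ p := by
  rcases eq_or_ne c 0 with rfl | hc
  · have h0 := h.ae_eq_zero_of_hasSubgaussianMGF_zero
    have : ∫ ω, X ω ^ (2 * p) ∂P = 0 := by
      refine integral_eq_zero_of_ae ?_
      filter_upwards [h0] with ω hω
      rw [hω]; simp; omega
    rw [this]; positivity
  have hc0 : (0 : ℝ) < c := by positivity
  have hp0 : (0 : ℝ) < p := by exact_mod_cast hp
  -- Up to constants this optimizes the exponential bound for `x^(2p)`: the moment generating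
  -- function at `± t` is at most `e^p`.
  obtain ⟨t, ht⟩ : ∃ t : ℝ, t = √(2 * p / c) := ⟨_, rfl⟩
  have ht2 : t ^ 2 = 2 * p / c := by rw [ht, Real.sq_sqrt (by positivity)]
  have ht0 : 0 < t := by rw [ht]; positivity
  have hpt (x : ℝ) : x ^ (2 * p) ≤ (2 * p : ℝ) ^ (2 * p) / t ^ (2 * p) *
      (Real.exp (t * x) + Real.exp (-t * x)) := by
    have h1 := Real.pow_div_factorial_le_exp |t * x| (abs_nonneg _) (2 * p)
    have h2 : Real.exp |t * x| ≤ Real.exp (t * x) + Real.exp (-t * x) := by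
      rcases abs_cases (t * x) with ⟨h, _⟩ | ⟨h, _⟩ <;> rw [h]
      · linarith [Real.exp_pos (-t * x)]
      · rw [neg_mul]; linarith [Real.exp_pos (t * x)]
    rw [Even.pow_abs (even_two_mul p), div_le_iff₀ (by positivity), mul_pow] at h1
    have h3 : ((2 * p).factorial : ℝ) ≤ (2 * p : ℝ) ^ (2 * p) := by
      exact_mod_cast Nat.factorial_le_pow (2 * p)
    rw [div_mul_eq_mul_div, le_div_iff₀ (by positivity)]
    calc x ^ (2 * p) * t ^ (2 * p) = t ^ (2 * p) * x ^ (2 * p) := mul_comm _ _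
      _ ≤ Real.exp |t * x| * ((2 * p).factorial : ℝ) := h1
      _ ≤ (Real.exp (t * x) + Real.exp (-t * x)) * (2 * p : ℝ) ^ (2 * p) := by gcongr
      _ = _ := mul_comm _ _
  have hexp (u : ℝ) (hu : u ^ 2 = t ^ 2) : ∫ ω, Real.exp (u * X ω) ∂P ≤ Real.exp p := by
    refine (h.mgf_le u).trans (le_of_eq ?_)
    rw [hu, ht2]; congr 1; field_simp
  calc ∫ ω, X ω ^ (2 * p) ∂P
      ≤ ∫ ω, (2 * p : ℝ) ^ (2 * p) / t ^ (2 * p) *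
          (Real.exp (t * X ω) + Real.exp (-t * X ω)) ∂P := by
        refine integral_mono ?_ ?_ fun ω => hpt (X ω)
        · have := (h.memLp (2 * p : ℕ)).integrable_norm_pow (by omega)
          simpa [Even.pow_abs (even_two_mul p)] using this
        · exact ((h.integrable_exp_mul t).add (h.integrable_exp_mul (-t))).const_mul _
    _ ≤ (2 * p : ℝ) ^ (2 * p) / t ^ (2 * p) * (Real.exp p + Real.exp p) := by
        rw [integral_const_mul, integral_add (h.integrable_exp_mul t) (h.integrable_exp_mul (-t))]
        gcongr
        · exact hexp t rfl
        · exact hexp (-t) (neg_sq t)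
    _ = 2 * (2 * Real.exp 1 * p * c) ^ p := by
        rw [pow_mul t, ht2, pow_mul, ← div_pow]
        have : Real.exp p = Real.exp 1 ^ p := by rw [← Real.exp_nat_mul]; simp
        rw [this, ← two_mul, mul_left_comm, ← mul_pow]
        congr 2
        field_simp
    _ ≤ 2 ^ p * (2 * Real.exp 1 * p * c) ^ p := by
        gcongr
        exact le_self_pow₀ (by norm_num) (by omega)
    _ = (4 * Real.exp 1 * p * c) ^ p := by rw [← mul_pow]; ring

end SubGaussian

section Model

variable {d : ℕ} {DX : Measure (E d)} [IsProbabilityMeasure DX] {N : Measure ℝ}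
  [IsProbabilityMeasure N] {R : ℝ} {σ : ℝ≥0}

/-- Given `x`, the product is sub-Gaussian with parameter `σ² x_j² ≤ σ² R²`; integrating this
uniform bound over `x` keeps it. -/
lemma hasSubgaussianMGF_noise_mul (hR : ∀ᵐ x ∂DX, ∀ j, |x j| ≤ R)
    (hσ : HasSubgaussianMGF id (σ ^ 2) N) (j : Fin d) :
    HasSubgaussianMGF (fun p : E d × ℝ => p.2 * p.1 j) (σ ^ 2 * (Real.toNNReal R) ^ 2)
      (DX.prod N) := by
  have hbound (t : ℝ) : ∀ᵐ x ∂DX, ∫ ξ, Real.exp (t * (ξ * x j)) ∂N ≤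
      Real.exp ((σ ^ 2 * (Real.toNNReal R) ^ 2 : ℝ≥0) * t ^ 2 / 2) := by
    filter_upwards [hR] with x hx
    have h1 := hσ.mgf_le (t * x j)
    simp only [mgf, id] at h1
    have hR0 : 0 ≤ R := (abs_nonneg _).trans (hx j)
    calc ∫ ξ, Real.exp (t * (ξ * x j)) ∂N = ∫ ξ, Real.exp (t * x j * ξ) ∂N := by
          refine integral_congr_ae (.of_forall fun ξ => ?_)
          simp only; ring_nf
      _ ≤ _ := h1
      _ ≤ _ := by
        have h2 : x j ^ 2 ≤ R ^ 2 := by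
          rw [← sq_abs]; exact pow_le_pow_left₀ (abs_nonneg _) (hx j) 2
        push_cast
        rw [Real.coe_toNNReal R hR0]
        have : (σ : ℝ) ^ 2 * (t * x j) ^ 2 ≤ (σ : ℝ) ^ 2 * R ^ 2 * t ^ 2 := by
          calc (σ : ℝ) ^ 2 * (t * x j) ^ 2 = (σ : ℝ) ^ 2 * t ^ 2 * (x j ^ 2) := by ring
            _ ≤ (σ : ℝ) ^ 2 * t ^ 2 * R ^ 2 := by gcongr
            _ = _ := by ring
        gcongr
  have hint (t : ℝ) : Integrable (fun p : E d × ℝ => Real.exp (t * (p.2 * p.1 j)))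
      (DX.prod N) := by
    rw [integrable_prod_iff (by fun_prop)]
    constructor
    · refine .of_forall fun x => ?_
      have := hσ.integrable_exp_mul (t * x j)
      refine this.congr (.of_forall fun ξ => ?_)
      simp only [id]; ring_nf
    · refine Integrable.of_bound
        (C := Real.exp ((σ ^ 2 * (Real.toNNReal R) ^ 2 : ℝ≥0) * t ^ 2 / 2)) ?_ ?_
      · exact (StronglyMeasurable.integral_prod_right (by
          exact Measurable.stronglyMeasurable (by fun_prop))).aestronglyMeasurable
      · filter_upwards [hbound t] with x hx
        rw [Real.norm_of_nonneg (integral_nonneg fun _ => norm_nonneg _)]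
        simpa using hx
  refine ⟨hint, fun t => ?_⟩
  rw [mgf, integral_prod _ (hint t)]
  calc _ ≤ ∫ x, Real.exp ((σ ^ 2 * (Real.toNNReal R) ^ 2 : ℝ≥0) * t ^ 2 / 2) ∂DX :=
        integral_mono_ae (hint t).integral_prod_left (integrable_const _) (hbound t)
    _ = _ := by simp

/-- The proxy variance of one coordinate of the gradient of the loss at one example. -/
noncomputable def gradVar (s : ℕ) (R : ℝ) (σ : ℝ≥0) (r : ℝ) : ℝ :=
  16 * s * R ^ 4 * r ^ 2 + 8 * σ ^ 2 * R ^ 2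

lemma gradVar_nonneg (s : ℕ) (R : ℝ) (σ : ℝ≥0) (r : ℝ) : 0 ≤ gradVar s R σ r := by
  unfold gradVar; positivity

/-- The derivative splits into `2 ⟨θ - θs, x⟩ x_j`, which is bounded so that Hoeffding's lemma
applies, and `-2 ξ x_j`. Both contain `x` and are dependent, so the square roots of the parameters
add. The first part shrinks with `‖θ - θs‖`, which makes the noise proportional to the excess apart
from the label noise. -/
lemma hasSubgaussianMGF_lossDeriv (hR : ∀ᵐ x ∂DX, ∀ j, |x j| ≤ R)
    (hσ : HasSubgaussianMGF id (σ ^ 2) N) {s : ℕ} {θs θ : E d}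
    (hθ : l0 (θ - θs) ≤ 2 * s) (j : Fin d) :
    HasSubgaussianMGF
      (fun z : E d × ℝ =>
        lossDeriv z.2 (inner ℝ θ z.1) * z.1 j - 2 * covOp DX (θ - θs) j)
      (Real.toNNReal (gradVar s R σ ‖θ - θs‖)) (modelLaw DX N θs) := by
  obtain ⟨x₀, hx₀⟩ := hR.exists
  have hR0 : 0 ≤ R := (abs_nonneg _).trans (hx₀ j)
  obtain ⟨m, hm⟩ : ∃ m : ℝ, m = 2 * (√(2 * s : ℕ) * R * ‖θ - θs‖) * R := ⟨_, rfl⟩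
  have hm0 : 0 ≤ m := by rw [hm]; positivity
  have h1 : HasSubgaussianMGF (fun x : E d => 2 * (inner ℝ (θ - θs) x * x j)
      - 2 * covOp DX (θ - θs) j) ((‖m - -m‖₊ / 2) ^ 2) DX := by
    have := hasSubgaussianMGF_of_mem_Icc (μ := DX)
      (X := fun x : E d => 2 * (inner ℝ (θ - θs) x * x j)) (a := -m) (b := m) (by fun_prop) ?_
    · rwa [integral_const_mul, ← covOp_apply hR] at this
    · filter_upwards [hR] with x hx
      rw [Set.mem_Icc, ← abs_le, abs_mul, abs_mul, abs_two, hm, mul_assoc 2]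
      have := abs_inner_le hθ hx hR0
      gcongr
      exact hx j
  have h2 : HasSubgaussianMGF (fun p : E d × ℝ => 2 * (inner ℝ (θ - θs) p.1 * p.1 j)
      - 2 * covOp DX (θ - θs) j) ((‖m - -m‖₊ / 2) ^ 2) (DX.prod N) := by
    have h : HasSubgaussianMGF (fun x : E d => 2 * (inner ℝ (θ - θs) x * x j)
      - 2 * covOp DX (θ - θs) j) ((‖m - -m‖₊ / 2) ^ 2) ((DX.prod N).map Prod.fst) := by
      rwa [measurePreserving_fst.map_eq]
    exact HasSubgaussianMGF.of_map measurable_fst.aemeasurable h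
  have h3 := h2.add (hasSubgaussianMGF_mul_left (hasSubgaussianMGF_noise_mul hR hσ j) (-2))
  rw [← HasSubgaussianMGF.id_map_iff (by unfold lossDeriv; fun_prop), modelLaw,
    Measure.map_map (by unfold lossDeriv; fun_prop) (measurable_model θs),
    HasSubgaussianMGF.id_map_iff (by unfold lossDeriv; fun_prop)]
  refine hasSubgaussianMGF_mono (h3.congr (.of_forall fun p => ?_)) ?_
  · simp only [lossDeriv, Function.comp, inner_sub_left]; ring
  · rw [← NNReal.coe_le_coe, Real.coe_toNNReal _ (gradVar_nonneg _ _ _ _)]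
    push_cast
    have e1 : ‖m - -m‖ / 2 = m := by
      rw [Real.norm_of_nonneg (by linarith)]; ring
    rw [e1, Real.sqrt_sq hm0, Real.coe_toNNReal R hR0]
    rw [Real.coe_toNNReal _ (sq_nonneg _),
      show (-2 : ℝ) ^ 2 * ((σ : ℝ) ^ 2 * R ^ 2) = (2 * σ * R) ^ 2 by ring,
      Real.sqrt_sq (by positivity)]
    have e3 : (m + 2 * σ * R) ^ 2 ≤ 2 * m ^ 2 + 2 * (2 * σ * R) ^ 2 := by
      nlinarith [sq_nonneg (m - 2 * σ * R)]
    refine e3.trans (le_of_eq ?_)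
    have e4 : √((2 * s : ℕ) : ℝ) ^ 2 = 2 * s := by rw [Real.sq_sqrt (by positivity)]; push_cast; rfl
    rw [hm, gradVar]
    linear_combination (8 * R ^ 4 * ‖θ - θs‖ ^ 2) * e4

/-- The moments of the error of the averaged gradient at a fixed parameter. -/
lemma integral_batch_error_pow_le {Ω : Type*} [MeasurableSpace Ω] {P : Measure Ω}
    (hR : ∀ᵐ x ∂DX, ∀ j, |x j| ≤ R)
    (hσ : HasSubgaussianMGF id (σ ^ 2) N) {s : ℕ} {θs θ : E d}
    (hθ : l0 (θ - θs) ≤ 2 * s) (j : Fin d) {z : ℕ → Ω → E d × ℝ} (hz : ∀ b, Measurable (z b))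
    (hlaw : ∀ b, P.map (z b) = modelLaw DX N θs) (hind : iIndepFun z P) {B : ℕ} (hB : 0 < B)
    {p : ℕ} (hp : 1 ≤ p) :
    Integrable (fun ω => (1 / (B : ℝ) * ∑ b ∈ Finset.range B,
        lossDeriv (z b ω).2 (inner ℝ θ (z b ω).1) * (z b ω).1 j
        - 2 * covOp DX (θ - θs) j) ^ (2 * p)) P ∧
    ∫ ω, (1 / (B : ℝ) * ∑ b ∈ Finset.range B,
        lossDeriv (z b ω).2 (inner ℝ θ (z b ω).1) * (z b ω).1 j
        - 2 * covOp DX (θ - θs) j) ^ (2 * p) ∂P ≤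
      (4 * Real.exp 1 * p * (gradVar s R σ ‖θ - θs‖ / B)) ^ p := by
  have hB0 : (0 : ℝ) < B := by exact_mod_cast hB
  have hf : Measurable fun z : E d × ℝ =>
      lossDeriv z.2 (inner ℝ θ z.1) * z.1 j - 2 * covOp DX (θ - θs) j := by
    unfold lossDeriv; fun_prop
  have h1 (b : ℕ) : HasSubgaussianMGF (fun ω =>
      lossDeriv (z b ω).2 (inner ℝ θ (z b ω).1) * (z b ω).1 j - 2 * covOp DX (θ - θs) j)
      (Real.toNNReal (gradVar s R σ ‖θ - θs‖)) P := by
    have := hasSubgaussianMGF_lossDeriv hR hσ hθ j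
    rw [← hlaw b] at this
    exact HasSubgaussianMGF.of_map (hz b).aemeasurable this
  have h2 := HasSubgaussianMGF.sum_of_iIndepFun (s := Finset.range B)
    (hind.comp (fun _ => fun z : E d × ℝ =>
      lossDeriv z.2 (inner ℝ θ z.1) * z.1 j - 2 * covOp DX (θ - θs) j) fun _ => hf)
    fun b _ => h1 b
  have h3 : HasSubgaussianMGF (fun ω => 1 / (B : ℝ) * ∑ b ∈ Finset.range B,
        lossDeriv (z b ω).2 (inner ℝ θ (z b ω).1) * (z b ω).1 j
        - 2 * covOp DX (θ - θs) j)
      (Real.toNNReal (gradVar s R σ ‖θ - θs‖ / B)) P := by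
    refine hasSubgaussianMGF_mono ((hasSubgaussianMGF_mul_left h2 (1 / (B : ℝ))).congr
      (.of_forall fun ω => ?_)) ?_
    · simp only [Finset.sum_sub_distrib, Finset.sum_const, Finset.card_range, nsmul_eq_mul,
        Function.comp]
      field_simp
    · have hv := gradVar_nonneg s R σ ‖θ - θs‖
      rw [← NNReal.coe_le_coe, Real.coe_toNNReal _ (by positivity)]
      simp only [Finset.sum_const, Finset.card_range, nsmul_eq_mul]
      push_cast
      rw [Real.coe_toNNReal _ hv, Real.coe_toNNReal _ (sq_nonneg _)]
      refine le_of_eq ?_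
      field_simp
  refine ⟨?_, ?_⟩
  · have := (h3.memLp (2 * p : ℕ)).integrable_norm_pow (by omega)
    simpa [Even.pow_abs (even_two_mul p)] using this
  · have := integral_pow_le_of_hasSubgaussianMGF h3 hp
    rwa [Real.coe_toNNReal _ (div_nonneg (gradVar_nonneg _ _ _ _) hB0.le)] at this

end Model

/-! ### Decoupling from the past, and recursions in `L^p` -/

section Decoupling

variable {Ω : Type*} {m : MeasurableSpace Ω} [mΩ : MeasurableSpace Ω] {P : Measure Ω}
  [IsProbabilityMeasure P]

/-- The joint law is a product, so the second variable may be replaced by an independent copy. With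
`X` the iterate and `Y` the fresh batch, the inner integral is then taken at a fixed parameter. -/
lemma lintegral_comp_prod_of_indepFun {α β : Type*} [MeasurableSpace α] [MeasurableSpace β]
    {X : Ω → α} {Y : Ω → β} (hX : Measurable X) (hY : Measurable Y) (h : IndepFun X Y P)
    {F : α × β → ENNReal} (hF : Measurable F) :
    ∫⁻ ω, F (X ω, Y ω) ∂P = ∫⁻ ω, ∫⁻ ω', F (X ω, Y ω') ∂P ∂P := by
  have := Measure.isProbabilityMeasure_map (μ := P) hX.aemeasurable
  have := Measure.isProbabilityMeasure_map (μ := P) hY.aemeasurable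
  have h1 := (indepFun_iff_map_prod_eq_prod_map_map hX.aemeasurable hY.aemeasurable).1 h
  rw [← lintegral_map (f := F) (g := fun ω => (X ω, Y ω)) hF (hX.prodMk hY), h1,
    lintegral_prod _ hF.aemeasurable, lintegral_map hF.lintegral_prod_right' hX]
  refine lintegral_congr fun ω => ?_
  exact lintegral_map (hF.comp measurable_prodMk_left) hY

/-- Independent draws from `D`, also independent of the past `m`. -/
structure FreshBatch {Ω α : Type*} [MeasurableSpace α] (m : MeasurableSpace Ω)
    [MeasurableSpace Ω] (D : Measure α) (P : Measure Ω) (z : ℕ → Ω → α) : Prop where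
  meas : ∀ b, Measurable (z b)
  law : ∀ b, P.map (z b) = D
  iIndep : iIndepFun z P
  indep : Indep m (⨆ b, MeasurableSpace.comap (z b) inferInstance) P

lemma FreshBatch.indepFun {Ω : Type*} {m : MeasurableSpace Ω} [MeasurableSpace Ω] {P : Measure Ω}
    {α β : Type*} [MeasurableSpace α] [MeasurableSpace β]
    {D : Measure α} {z : ℕ → Ω → α} (h : FreshBatch m D P z)
    {X : Ω → β} (hX : Measurable[m] X) : IndepFun X (fun ω b => z b ω) P := by
  rw [IndepFun_iff_Indep]
  refine indep_of_indep_of_le_left (indep_of_indep_of_le_right h.indep ?_) hX.comap_le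
  simp only [MeasurableSpace.pi, MeasurableSpace.comap_iSup, MeasurableSpace.comap_comp]
  exact le_rfl

end Decoupling

section Moments

variable {Ω : Type*} [mΩ : MeasurableSpace Ω] {P : Measure Ω} [IsProbabilityMeasure P]

/-- A recursion driven by the maximal squared error, in `L^p`. -/
lemma eLpNorm_le_of_error_moments {d p : ℕ} (hp : 1 ≤ p) (hdp : (d : ℝ) ≤ Real.exp p)
    {G G' : Ω → ℝ} {e : Fin d → Ω → ℝ} (hG : Measurable G) (hG0 : ∀ ω, 0 ≤ G ω)
    (hG'0 : ∀ ω, 0 ≤ G' ω) (he : ∀ j, Measurable (e j)) {a c A b u : ℝ}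
    (ha : 0 ≤ a) (hc : 0 ≤ c) (hA : 0 ≤ A) (hb : 0 ≤ b) (hu : 0 ≤ u)
    (hmom : ∀ j, ∫⁻ ω, ENNReal.ofReal (e j ω ^ (2 * p)) ∂P ≤
      ∫⁻ ω, ENNReal.ofReal ((A * G ω + b) ^ p) ∂P)
    (hstep : ∀ ω W, 0 ≤ W → (∀ j, e j ω ^ 2 ≤ W) → G' ω ≤ a * G ω + c * W)
    (hGu : eLpNorm G p P ≤ ENNReal.ofReal u) :
    eLpNorm G' p P ≤ ENNReal.ofReal (a * u + c * (Real.exp 1 * (A * u + b))) := by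
  have hp0 : (p : ENNReal) ≠ 0 := by simp; omega
  have hpt : (p : ENNReal) ≠ ⊤ := by simp
  have hp1 : (1 : ENNReal) ≤ p := by exact_mod_cast hp
  have hpR : (0 : ℝ) < p := by exact_mod_cast hp
  -- The `ℓ^p` norm of the squared errors replaces their maximum: its `p`-th moment is a sum of `d`
  -- moments, and `d ≤ e^p` costs a factor `e` after the `p`-th root. Dependence between coordinates
  -- is irrelevant.
  obtain ⟨W, hW⟩ : ∃ W : Ω → ℝ, W = fun ω => (∑ j, e j ω ^ (2 * p)) ^ ((p : ℝ)⁻¹) := ⟨_, rfl⟩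
  have hs0 (ω : Ω) : 0 ≤ ∑ j, e j ω ^ (2 * p) :=
    Finset.sum_nonneg fun j _ => (even_two_mul p).pow_nonneg _
  have hW0 (ω : Ω) : 0 ≤ W ω := by rw [hW]; exact Real.rpow_nonneg (hs0 ω) _
  have hWm : Measurable W := by rw [hW]; fun_prop
  have heW (ω : Ω) (j : Fin d) : e j ω ^ 2 ≤ W ω := by
    rw [hW]
    have h1 : (e j ω ^ 2) ^ p ≤ ∑ j, e j ω ^ (2 * p) := by
      rw [← pow_mul]
      exact Finset.single_le_sum (f := fun j => e j ω ^ (2 * p))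
        (fun j _ => (even_two_mul p).pow_nonneg _) (Finset.mem_univ j)
    calc e j ω ^ 2 = ((e j ω ^ 2) ^ p) ^ ((p : ℝ)⁻¹) :=
          (Real.pow_rpow_inv_natCast (sq_nonneg _) (by omega)).symm
      _ ≤ _ := Real.rpow_le_rpow (by positivity) h1 (by positivity)
  have hV : eLpNorm (fun ω => A * G ω + b) p P ≤ ENNReal.ofReal (A * u + b) := by
    refine (eLpNorm_add_le (by fun_prop) (by fun_prop) hp1).trans ?_
    rw [ENNReal.ofReal_add (by positivity) hb]
    gcongr
    · have : eLpNorm (fun ω => A * G ω) p P = eLpNorm (A • G) p P := rfl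
      rw [this, eLpNorm_const_smul, ENNReal.ofReal_mul hA, Real.enorm_eq_ofReal hA]
      gcongr
    · rw [eLpNorm_const _ hp0 (IsProbabilityMeasure.ne_zero P)]
      simp [Real.enorm_eq_ofReal hb]
  have hWV : eLpNorm W p P ≤ ENNReal.ofReal (Real.exp 1) * ENNReal.ofReal (A * u + b) := by
    refine le_trans ?_ (mul_le_mul_right hV _)
    rw [eLpNorm_eq_lintegral_rpow_enorm_toReal hp0 hpt,
      eLpNorm_eq_lintegral_rpow_enorm_toReal hp0 hpt]
    simp only [ENNReal.toReal_natCast, ENNReal.rpow_natCast]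
    have h1 : ∫⁻ ω, ‖W ω‖ₑ ^ p ∂P = ∑ j, ∫⁻ ω, ENNReal.ofReal (e j ω ^ (2 * p)) ∂P := by
      rw [← lintegral_finsetSum _ fun j _ => by fun_prop]
      refine lintegral_congr fun ω => ?_
      rw [Real.enorm_eq_ofReal (hW0 ω), ← ENNReal.ofReal_pow (hW0 ω),
        ← ENNReal.ofReal_sum_of_nonneg fun j _ => (even_two_mul p).pow_nonneg _, hW]
      simp only
      rw [Real.rpow_inv_natCast_pow (hs0 ω) (by omega)]
    have h2 : ∑ j, ∫⁻ ω, ENNReal.ofReal (e j ω ^ (2 * p)) ∂P ≤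
        ENNReal.ofReal (Real.exp 1) ^ p * ∫⁻ ω, ‖A * G ω + b‖ₑ ^ p ∂P := by
      have h3 : ∫⁻ ω, ‖A * G ω + b‖ₑ ^ p ∂P = ∫⁻ ω, ENNReal.ofReal ((A * G ω + b) ^ p) ∂P := by
        refine lintegral_congr fun ω => ?_
        have : 0 ≤ A * G ω + b := by have := hG0 ω; positivity
        rw [Real.enorm_eq_ofReal this, ENNReal.ofReal_pow this]
      rw [h3]
      refine (Finset.sum_le_sum fun j _ => hmom j).trans ?_
      rw [Finset.sum_const, nsmul_eq_mul, Finset.card_univ, Fintype.card_fin,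
        ← ENNReal.ofReal_pow (Real.exp_pos 1).le, ← Real.exp_nat_mul, mul_one]
      gcongr
      rw [← ENNReal.ofReal_natCast]
      exact ENNReal.ofReal_le_ofReal hdp
    rw [h1]
    refine (ENNReal.rpow_le_rpow h2 (by positivity)).trans (le_of_eq ?_)
    rw [ENNReal.mul_rpow_of_nonneg _ _ (by positivity), ← ENNReal.rpow_natCast, ← ENNReal.rpow_mul]
    rw [mul_one_div_cancel hpR.ne', ENNReal.rpow_one]
  have hmono : eLpNorm G' p P ≤ eLpNorm (a • G + c • W) p P := by
    refine eLpNorm_mono_real fun ω => ?_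
    rw [Real.norm_of_nonneg (hG'0 ω)]
    exact hstep ω (W ω) (hW0 ω) (heW ω)
  refine hmono.trans ((eLpNorm_add_le (by fun_prop) (by fun_prop) hp1).trans ?_)
  rw [eLpNorm_const_smul, eLpNorm_const_smul, Real.enorm_eq_ofReal ha, Real.enorm_eq_ofReal hc,
    ENNReal.ofReal_add (by positivity) (by positivity), ENNReal.ofReal_mul ha,
    ENNReal.ofReal_mul hc, ENNReal.ofReal_mul (Real.exp_pos 1).le]
  gcongr

end Moments

section ErrorDef

variable {d : ℕ} {DX : Measure (E d)}

/-- The error of coordinate `j` of the averaged gradient, as a function of the parameter and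
the examples. -/
noncomputable def batchError (DX : Measure (E d)) (θs : E d) (B : ℕ) (θ : E d)
    (z : ℕ → E d × ℝ) (j : Fin d) : ℝ :=
  1 / (B : ℝ) * ∑ b ∈ Finset.range B, lossDeriv (z b).2 (inner ℝ θ (z b).1) * (z b).1 j
    - 2 * covOp DX (θ - θs) j

lemma measurable_batchError (θs : E d) (B : ℕ) (j : Fin d) :
    Measurable fun p : E d × (ℕ → E d × ℝ) => batchError DX θs B p.1 p.2 j := by
  have h1 : Measurable fun θ : E d => covOp DX (θ - θs) j := by
    have : Measurable fun v : E d => covOp DX v :=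
      (LinearMap.continuous_of_finiteDimensional (covOp DX)).measurable
    exact (EuclideanSpace.proj j : E d →L[ℝ] ℝ).measurable.comp (this.comp (by fun_prop))
  unfold batchError lossDeriv
  refine Measurable.sub (Measurable.const_mul (Finset.measurable_sum _ fun b _ => ?_) _)
    ((h1.comp measurable_fst).const_mul _)
  have hb : Measurable fun p : E d × (ℕ → E d × ℝ) => p.2 b :=
    (measurable_pi_apply b).comp measurable_snd
  have hb1 : Measurable fun p : E d × (ℕ → E d × ℝ) => (p.2 b).1 := hb.fst
  have hb2 : Measurable fun p : E d × (ℕ → E d × ℝ) => (p.2 b).2 := hb.snd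
  have hin : Measurable fun p : E d × (ℕ → E d × ℝ) => inner ℝ p.1 (p.2 b).1 :=
    measurable_fst.inner hb1
  have hj : Measurable fun p : E d × (ℕ → E d × ℝ) => (p.2 b).1 j :=
    (EuclideanSpace.proj j : E d →L[ℝ] ℝ).measurable.comp hb1
  exact ((hin.sub hb2).const_mul 2).mul hj

lemma measurable_form {G : E d →ₗ[ℝ] E d} (θs : E d) :
    Measurable fun θ : E d => inner ℝ (G (θ - θs)) (θ - θs) := by
  have : Continuous fun v : E d => G v := LinearMap.continuous_of_finiteDimensional G
  have : Continuous fun θ : E d => inner ℝ (G (θ - θs)) (θ - θs) := by fun_prop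
  exact this.measurable

end ErrorDef

section Error

variable {d : ℕ} {DX : Measure (E d)} [IsProbabilityMeasure DX] {N : Measure ℝ}
  [IsProbabilityMeasure N] {R : ℝ} {σ : ℝ≥0}

variable {Ω : Type*} {m : MeasurableSpace Ω} [mΩ : MeasurableSpace Ω] {P : Measure Ω}
  [IsProbabilityMeasure P]

/-- The moments of the error of the averaged gradient at a random parameter. -/
lemma lintegral_batchError_pow_le (hR : ∀ᵐ x ∂DX, ∀ j, |x j| ≤ R)
    (hσ : HasSubgaussianMGF id (σ ^ 2) N) {s : ℕ} {L μ : ℝ} (hμ : 0 < μ) {θs : E d}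
    (hform : RestrictedForm (covOp DX) s L μ)
    (hm : m ≤ mΩ) {θ : Ω → E d} (hθm : Measurable[m] θ)
    (hθ : ∀ ω, l0 (θ ω - θs) ≤ 2 * s) {z : ℕ → Ω → E d × ℝ}
    (hz : FreshBatch m (modelLaw DX N θs) P z) {B : ℕ} (hB : 0 < B) {p : ℕ} (hp : 1 ≤ p)
    (j : Fin d) :
    ∫⁻ ω, ENNReal.ofReal (batchError DX θs B (θ ω) (fun b => z b ω) j ^ (2 * p)) ∂P ≤
      ∫⁻ ω, ENNReal.ofReal
        ((4 * Real.exp 1 * p / B * (32 * s * R ^ 4 / μ) *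
          inner ℝ (covOp DX (θ ω - θs)) (θ ω - θs)
          + 4 * Real.exp 1 * p / B * (8 * σ ^ 2 * R ^ 2)) ^ p) ∂P := by
  have hB0 : (0 : ℝ) < B := by exact_mod_cast hB
  have hF : Measurable fun x : E d × (ℕ → E d × ℝ) =>
      ENNReal.ofReal (batchError DX θs B x.1 x.2 j ^ (2 * p)) :=
    ((measurable_batchError θs B j).pow_const _).ennreal_ofReal
  have h1 := lintegral_comp_prod_of_indepFun (hθm.mono hm le_rfl)
    (measurable_pi_lambda _ hz.meas) (hz.indepFun hθm) hF
  rw [h1]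
  refine lintegral_mono fun ω => ?_
  obtain ⟨h2, h3⟩ := integral_batch_error_pow_le hR hσ (hθ ω) j hz.meas hz.law hz.iIndep hB hp
  refine (ofReal_integral_eq_lintegral_ofReal h2
    (.of_forall fun ω' => (even_two_mul p).pow_nonneg _)).symm.le.trans ?_
  refine ENNReal.ofReal_le_ofReal (h3.trans ?_)
  have h4 := gradVar_nonneg s R σ ‖θ ω - θs‖
  refine pow_le_pow_left₀ (by positivity) ?_ p
  have h5 := hform.lower _ (hθ ω)
  have h6 : gradVar s R σ ‖θ ω - θs‖ ≤
      32 * s * R ^ 4 / μ * inner ℝ (covOp DX (θ ω - θs)) (θ ω - θs) + 8 * σ ^ 2 * R ^ 2 := by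
    -- Restricted strong convexity turns the distance in the proxy variance into the excess risk,
    -- which closes the recursion.
    have h7 : ‖θ ω - θs‖ ^ 2 ≤ 2 / μ * inner ℝ (covOp DX (θ ω - θs)) (θ ω - θs) := by
      rw [div_mul_eq_mul_div, le_div_iff₀ hμ]; linarith
    have h8 : 16 * s * R ^ 4 * ‖θ ω - θs‖ ^ 2 ≤
        16 * s * R ^ 4 * (2 / μ * inner ℝ (covOp DX (θ ω - θs)) (θ ω - θs)) := by gcongr
    unfold gradVar
    have h9 : 16 * s * R ^ 4 * (2 / μ * inner ℝ (covOp DX (θ ω - θs)) (θ ω - θs)) =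
      32 * s * R ^ 4 / μ * inner ℝ (covOp DX (θ ω - θs)) (θ ω - θs) := by ring
    linarith
  calc 4 * Real.exp 1 * p * (gradVar s R σ ‖θ ω - θs‖ / B)
      = 4 * Real.exp 1 * p / B * gradVar s R σ ‖θ ω - θs‖ := by ring
    _ ≤ 4 * Real.exp 1 * p / B * (32 * s * R ^ 4 / μ *
          inner ℝ (covOp DX (θ ω - θs)) (θ ω - θs) + 8 * σ ^ 2 * R ^ 2) := by gcongr
    _ = _ := by ring

end Error

attribute [irreducible] batchError

/-! ### One stochastic step in `L^p` -/

section Steps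

variable {d : ℕ} {DX : Measure (E d)} [IsProbabilityMeasure DX] {N : Measure ℝ}
  [IsProbabilityMeasure N] {R : ℝ} {σ : ℝ≥0}
  {Ω : Type*} {m : MeasurableSpace Ω} [mΩ : MeasurableSpace Ω] {P : Measure Ω}
  [IsProbabilityMeasure P]

lemma dotOn_eq_inner {S : Finset (Fin d)} {θ : E d} (h : supp θ ⊆ S) (x : E d) :
    dotOn S θ x = inner ℝ θ x := by
  rw [real_inner_comm, inner_eq_sum_of_supp_subset h, dotOn]
  simp only [mul_comm]

/-- One step of gradient descent with fresh batches (one for each coordinate), for which the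
deterministic recursion `hstep` holds, in `L^p`. -/
lemma eLpNorm_form_step_le (hR : ∀ᵐ x ∂DX, ∀ j, |x j| ≤ R)
    (hσ : HasSubgaussianMGF id (σ ^ 2) N) {s : ℕ} {L μ : ℝ} (hL : 0 < L) (hμ : 0 < μ) {θs : E d}
    (hform : RestrictedForm (covOp DX) s L μ)
    (hm : m ≤ mΩ) {θ θ' : Ω → E d} (hθm : Measurable[m] θ)
    (hθ : ∀ ω, l0 (θ ω - θs) ≤ 2 * s) {z : Fin d → ℕ → Ω → E d × ℝ}
    (hz : ∀ j, FreshBatch m (modelLaw DX N θs) P (z j)) {B : ℕ} (hB : 0 < B) {p : ℕ}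
    (hp : 1 ≤ p) (hdp : (d : ℝ) ≤ Real.exp p) {a u r₁ r₂ : ℝ} (ha : 0 ≤ a) (hu : 0 ≤ u)
    (hstep : ∀ ω W, 0 ≤ W →
      (∀ j, batchError DX θs B (θ ω) (fun b => z j b ω) j ^ 2 ≤ W) →
      inner ℝ (covOp DX (θ' ω - θs)) (θ' ω - θs) ≤
        a * inner ℝ (covOp DX (θ ω - θs)) (θ ω - θs) + 3 * s / L * W)
    (hr₁ : 12 * Real.exp 1 ^ 2 * p * s / (L * B) * (32 * s * R ^ 4 / μ) ≤ r₁)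
    (hr₂ : 12 * Real.exp 1 ^ 2 * p * s / (L * B) * (8 * σ ^ 2 * R ^ 2) ≤ r₂)
    (hGu : eLpNorm (fun ω => inner ℝ (covOp DX (θ ω - θs)) (θ ω - θs)) p P ≤
      ENNReal.ofReal u) :
    eLpNorm (fun ω => inner ℝ (covOp DX (θ' ω - θs)) (θ' ω - θs)) p P ≤
      ENNReal.ofReal (a * u + r₁ * u + r₂) := by
  have hB0 : (0 : ℝ) < B := by exact_mod_cast hB
  have hθm' : Measurable θ := hθm.mono hm le_rfl
  have hG : Measurable fun ω => inner ℝ (covOp DX (θ ω - θs)) (θ ω - θs) :=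
    Measurable.comp (g := fun θ : E d => inner ℝ (covOp DX (θ - θs)) (θ - θs))
      (measurable_form θs) hθm'
  have he (j : Fin d) : Measurable fun ω => batchError DX θs B (θ ω) (fun b => z j b ω) j := by
    have hzm : Measurable fun ω (b : ℕ) => z j b ω := measurable_pi_lambda _ (hz j).meas
    have hpair : Measurable fun ω => (θ ω, fun b : ℕ => z j b ω) := hθm'.prodMk hzm
    exact (measurable_batchError θs B j).comp hpair
  have h0 := eLpNorm_le_of_error_moments (a := a) (c := 3 * s / L)
    (A := 4 * Real.exp 1 * p / B * (32 * s * R ^ 4 / μ))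
    (b := 4 * Real.exp 1 * p / B * (8 * σ ^ 2 * R ^ 2)) hp hdp
    (G' := fun ω => inner ℝ (covOp DX (θ' ω - θs)) (θ' ω - θs))
    hG (fun ω => hform.nonneg _) (fun ω => hform.nonneg _) he ha
    (by positivity) (by positivity) (by positivity) hu
    (fun j => lintegral_batchError_pow_le hR hσ hμ hform hm hθm hθ (hz j) hB hp j) hstep hGu
  refine h0.trans (ENNReal.ofReal_le_ofReal ?_)
  have h1 := mul_le_mul_of_nonneg_right hr₁ hu
  have h2 (x y : ℝ) : 3 * s / L * (Real.exp 1 * (4 * Real.exp 1 * p / B * x * u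
      + 4 * Real.exp 1 * p / B * y)) =
      12 * Real.exp 1 ^ 2 * p * s / (L * B) * x * u
      + 12 * Real.exp 1 ^ 2 * p * s / (L * B) * y := by
    field_simp; ring
  rw [h2]
  linarith

/-- The exploration step in `L^p`. -/
lemma eLpNorm_exploration_step_le (hR : ∀ᵐ x ∂DX, ∀ j, |x j| ≤ R)
    (hσ : HasSubgaussianMGF id (σ ^ 2) N) {s : ℕ} (hs : 1 ≤ s) {L μ : ℝ} (hL : 0 < L)
    (hμ : 0 < μ) (hμL : μ ≤ L) {θs : E d} (hform : RestrictedForm (covOp DX) s L μ)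
    (hθs : 96 * (L / μ) ^ 2 * l0 θs ≤ s) {H : E d → E d} (hH : IsHardThresholding s H)
    (hm : m ≤ mΩ) {θ : Ω → E d} (hθm : Measurable[m] θ)
    (hθ : ∀ ω, l0 (θ ω) ≤ s) {z : ℕ → ℕ → Ω → E d × ℝ} {len : ℕ}
    (hz : ∀ i, FreshBatch m (modelLaw DX N θs) P (z i)) {B : ℕ} (hB : 0 < B) {p : ℕ}
    (hp : 1 ≤ p) (hdp : (d : ℝ) ≤ Real.exp p) {u r₁ r₂ : ℝ} (hu : 0 ≤ u)
    (hr₁ : 12 * Real.exp 1 ^ 2 * p * s / (L * B) * (32 * s * R ^ 4 / μ) ≤ r₁)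
    (hr₂ : 12 * Real.exp 1 ^ 2 * p * s / (L * B) * (8 * σ ^ 2 * R ^ 2) ≤ r₂)
    (hGu : eLpNorm (fun ω => inner ℝ (covOp DX (θ ω - θs)) (θ ω - θs)) p P ≤
      ENNReal.ofReal u) :
    eLpNorm (fun ω => inner ℝ
        (covOp DX (H (θ ω - (1 / 2 / L) • explorationGrad len B (fun i b => z i b ω) (θ ω)) - θs))
        (H (θ ω - (1 / 2 / L) • explorationGrad len B (fun i b => z i b ω) (θ ω)) - θs)) p P ≤
      ENNReal.ofReal ((1 - 1 / (8 * (L / μ))) * u + r₁ * u + r₂) := by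
  have hκ : 1 ≤ L / μ := by rwa [le_div_iff₀ hμ, one_mul]
  have hθs' : l0 θs ≤ s := by
    have h1 : (l0 θs : ℝ) ≤ 96 * (L / μ) ^ 2 * l0 θs :=
      le_mul_of_one_le_left (by positivity) (by nlinarith [one_le_pow₀ hκ (n := 2)])
    exact_mod_cast h1.trans hθs
  -- Coordinate `j` uses the batch of its block `j / len`. Each of these batches is independent of
  -- the past, which is all that the coordinatewise moments require.
  refine eLpNorm_form_step_le hR hσ hL hμ hform hm hθm
    (fun ω => (l0_sub_le _ _).trans (by have := hθ ω; omega))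
    (z := fun j => z ((j : ℕ) / len)) (fun j => hz _) hB hp hdp
    (sub_nonneg.2 ?_) hu (fun ω W hW0 hW => ?_) hr₁ hr₂ hGu
  · rw [div_le_one (by positivity)]; linarith
  · refine hform.form_hardThresholding_le hL hμ hμL (u := θs)
      (e := WithLp.toLp 2 fun j => batchError DX θs B (θ ω) (fun b => z ((j : ℕ) / len) b ω) j)
      hθs hs (hθ ω) (hH.sparse _) (fun j => ?_) (hH.minimal _) hW hW0
    simp only [PiLp.sub_apply, PiLp.smul_apply, smul_eq_mul, explorationGrad, batchError,
      dotOn_eq_inner subset_rfl]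
    field_simp
    ring

/-- The exploitation step in `L^p`. The factor `a` is smaller than one if the support of the
minimizer is contained in the support of the starting point. -/
lemma eLpNorm_exploitation_step_le (hR : ∀ᵐ x ∂DX, ∀ j, |x j| ≤ R)
    (hσ : HasSubgaussianMGF id (σ ^ 2) N) {s : ℕ} {L μ : ℝ} (hL : 0 < L)
    (hμ : 0 < μ) (hμL : μ ≤ L) {θs : E d} (hform : RestrictedForm (covOp DX) s L μ)
    (hθs : l0 θs ≤ s)
    (hm : m ≤ mΩ) {θ : Ω → E d} (hθm : Measurable[m] θ)
    {S : Ω → Finset (Fin d)} (hS : ∀ ω, (S ω).card ≤ s)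
    (hθ : ∀ ω, supp (θ ω) ⊆ S ω) {z : ℕ → Ω → E d × ℝ}
    (hz : FreshBatch m (modelLaw DX N θs) P z) {B : ℕ} (hB : 0 < B) {p : ℕ}
    (hp : 1 ≤ p) (hdp : (d : ℝ) ≤ Real.exp p) {a u r₁ r₂ : ℝ}
    (ha : a = 1 ∨ a = 1 - 1 / (2 * (L / μ)) ∧ ∀ ω, supp θs ⊆ S ω) (hu : 0 ≤ u)
    (hr₁ : 12 * Real.exp 1 ^ 2 * p * s / (L * B) * (32 * s * R ^ 4 / μ) ≤ r₁)
    (hr₂ : 12 * Real.exp 1 ^ 2 * p * s / (L * B) * (8 * σ ^ 2 * R ^ 2) ≤ r₂)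
    (hGu : eLpNorm (fun ω => inner ℝ (covOp DX (θ ω - θs)) (θ ω - θs)) p P ≤
      ENNReal.ofReal u) :
    eLpNorm (fun ω => inner ℝ
        (covOp DX (θ ω - (1 / 2 / L) • exploitationGrad (S ω) B (fun b => z b ω) (θ ω) - θs))
        (θ ω - (1 / 2 / L) • exploitationGrad (S ω) B (fun b => z b ω) (θ ω) - θs)) p P ≤
      ENNReal.ofReal (a * u + r₁ * u + r₂) := by
  have hκ : 1 ≤ L / μ := by rwa [le_div_iff₀ hμ, one_mul]
  have ha0 : 0 ≤ a := by
    rcases ha with rfl | ⟨rfl, -⟩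
    · exact zero_le_one
    · rw [sub_nonneg, div_le_one (by positivity)]; linarith
  refine eLpNorm_form_step_le hR hσ hL hμ hform hm hθm
    (fun ω => (l0_sub_le _ _).trans ?_)
    (z := fun _ => z) (fun _ => hz) hB hp hdp ha0 hu (fun ω W hW0 hW => ?_) hr₁ hr₂ hGu
  · have := (Finset.card_le_card (hθ ω)).trans (hS ω)
    simp only [l0] at hθs ⊢; omega
  · obtain ⟨e, he⟩ : ∃ e : E d,
        e = WithLp.toLp 2 fun j => batchError DX θs B (θ ω) (fun b => z b ω) j := ⟨_, rfl⟩
    obtain ⟨g, hg⟩ : ∃ g : E d, g = exploitationGrad (S ω) B (fun b => z b ω) (θ ω) := ⟨_, rfl⟩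
    have hge (j) : g j = if j ∈ S ω then 2 * covOp DX (θ ω - θs) j + e j else 0 := by
      rw [hg, he]
      simp only [exploitationGrad, batchError, dotOn_eq_inner (hθ ω)]
      congr 1
      ring
    have h1 : 1 / 2 / L / 2 * ∑ j ∈ S ω, e j ^ 2 ≤ 3 * s / L * W := by
      have : ∑ j ∈ S ω, e j ^ 2 ≤ s * W := by
        refine (Finset.sum_le_card_nsmul _ _ W fun j _ => ?_).trans ?_
        · rw [he]; exact hW j
        · rw [nsmul_eq_mul]; gcongr; exact hS ω
      calc _ ≤ 1 / 2 / L / 2 * (s * W) := by gcongr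
        _ = 1 / 4 * (s / L * W) := by ring
        _ ≤ 3 * (s / L * W) := by gcongr; norm_num
        _ = _ := by ring
    have h2 : θ ω - (1 / 2 / L) • g - θs = (θ ω - θs) - (1 / 2 / L) • g := by abel
    have h3 : 1 / 2 / L * L ≤ 1 := by field_simp; norm_num
    rw [← hg, h2]
    -- On an arbitrary support the gradient term is only nonnegative and is dropped; if `S ω`
    -- contains `supp θs`, then `θ ω - θs` is supported in `S ω` and the Polyak–Łojasiewicz
    -- inequality applies.
    rcases ha with rfl | ⟨rfl, hid⟩
    · have h4 := hform.form_sub_smul_le (hS ω) (θ ω - θs) e g (by positivity : 0 ≤ 1 / 2 / L) h3 hge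
      have h5 : 0 ≤ 1 / 2 / L / 2 * ∑ j ∈ S ω, (2 * covOp DX (θ ω - θs) j) ^ 2 :=
        mul_nonneg (by positivity) (Finset.sum_nonneg fun _ _ => sq_nonneg _)
      linarith
    · have hsub : supp (θ ω - θs) ⊆ S ω :=
        (supp_sub_subset _ _).trans (Finset.union_subset (hθ ω) (hid ω))
      have h4 := hform.form_sub_smul_le_of_supp_subset hμ (hS ω) hsub e g
        (by positivity : 0 ≤ 1 / 2 / L) h3 hge
      have h5 : 1 / (2 * (L / μ)) = 1 / 2 / L * μ := by field_simp
      rw [h5]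
      linarith

end Steps

/-! ### Measurability of the iterates -/

section Measurability

variable {d : ℕ} {Ω : Type*} [MeasurableSpace Ω]

lemma measurable_coord {f : Ω → E d} (hf : Measurable f) (j : Fin d) :
    Measurable fun ω => f ω j :=
  (EuclideanSpace.proj j : E d →L[ℝ] ℝ).measurable.comp hf

lemma measurable_of_coord {f : Ω → Fin d → ℝ} (hf : ∀ j, Measurable fun ω => f ω j) :
    Measurable fun ω => (WithLp.toLp 2 (f ω) : E d) :=
  (PiLp.continuous_toLp 2 (fun _ : Fin d => ℝ)).measurable.comp (measurable_pi_lambda _ hf)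

lemma measurable_batchGrad {θ : Ω → E d} (hθ : Measurable θ) {z : ℕ → Ω → E d × ℝ}
    (hz : ∀ b, Measurable (z b)) (B : ℕ) (j : Fin d) :
    Measurable fun ω => (1 / (B : ℝ)) * ∑ b ∈ Finset.range B,
      lossDeriv (z b ω).2 (inner ℝ (θ ω) (z b ω).1) * (z b ω).1 j := by
  unfold lossDeriv
  refine Measurable.const_mul (Finset.measurable_sum _ fun b _ => ?_) _
  exact (((hθ.inner (hz b).fst).sub (hz b).snd).const_mul 2).mul (measurable_coord (hz b).fst j)

lemma measurable_explorationGrad {θ : Ω → E d} (hθ : Measurable θ)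
    {z : ℕ → ℕ → Ω → E d × ℝ} (hz : ∀ i b, Measurable (z i b)) (len B : ℕ) :
    Measurable fun ω => explorationGrad len B (fun i b => z i b ω) (θ ω) := by
  unfold explorationGrad
  refine measurable_of_coord fun j => ?_
  simp only [dotOn_eq_inner subset_rfl]
  exact measurable_batchGrad hθ (hz _) B j

lemma measurable_sub_smul {f g : Ω → E d} (hf : Measurable f) (hg : Measurable g) (c : ℝ) :
    Measurable fun ω => f ω - c • g ω := by fun_prop

lemma measurableSet_mem_supp {θ : Ω → E d} (hθ : Measurable θ) (j : Fin d) :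
    MeasurableSet {ω | j ∈ supp (θ ω)} := by
  simp only [mem_supp]
  exact (measurable_coord hθ j) (measurableSet_singleton 0).compl

lemma measurableSet_subset_supp {θ : Ω → E d} (hθ : Measurable θ) (S : Finset (Fin d)) :
    MeasurableSet {ω | S ⊆ supp (θ ω)} := by
  have : {ω | S ⊆ supp (θ ω)} = ⋂ j ∈ S, {ω | j ∈ supp (θ ω)} := by
    ext ω; simp [Finset.subset_iff]
  rw [this]
  exact Finset.measurableSet_biInter S fun j _ => measurableSet_mem_supp hθ j

lemma measurable_ite_subset_supp {θ : Ω → E d} (hθ : Measurable θ) (u : E d) :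
    Measurable fun ω => if supp u ⊆ supp (θ ω) then θ ω else u :=
  Measurable.ite (measurableSet_subset_supp hθ (supp u)) hθ measurable_const

lemma measurable_exploitationGrad {θ₀ θ : Ω → E d} (hθ₀ : Measurable θ₀) (hθ : Measurable θ)
    (hsupp : ∀ ω, supp (θ ω) ⊆ supp (θ₀ ω))
    {z : ℕ → Ω → E d × ℝ} (hz : ∀ b, Measurable (z b)) (B : ℕ) :
    Measurable fun ω => exploitationGrad (supp (θ₀ ω)) B (fun b => z b ω) (θ ω) := by
  unfold exploitationGrad
  refine measurable_of_coord fun j => ?_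
  simp only [fun ω => dotOn_eq_inner (hsupp ω)]
  exact Measurable.ite (measurableSet_mem_supp hθ₀ j) (measurable_batchGrad hθ hz B j)
    measurable_const

end Measurability

lemma supp_exploitation_subset {d : ℕ} (η : ℝ) (B : ℕ → ℕ) (z : ℕ → ℕ → E d × ℝ) (θ₀ : E d)
    (t : ℕ) : supp (exploitation η B z θ₀ t) ⊆ supp θ₀ := by
  induction t with
  | zero => exact subset_rfl
  | succ t ih =>
    intro j hj
    by_contra h
    refine mem_supp.1 hj ?_
    simp [exploitation, exploitationGrad, h, eq_zero_of_notMem ih h]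

lemma IsHardThresholding.apply_eq_self {d s : ℕ} {H : E d → E d} (hH : IsHardThresholding s H)
    {θ : E d} (hθ : l0 θ ≤ s) : H θ = θ := by
  have := hH.minimal θ θ hθ
  rw [sub_self, norm_zero] at this
  exact sub_eq_zero.1 (norm_le_zero_iff.1 this)

/-! ### The two phases as recursions in `L^p` -/

/-- The sparse regression model in which the algorithm runs. -/
structure SparseModel {d : ℕ} (DX : Measure (E d)) (N : Measure ℝ) (θs : E d) (R : ℝ) (σ : ℝ≥0)
    (s : ℕ) (L μ : ℝ) : Prop where
  bound : ∀ᵐ x ∂DX, ∀ j, |x j| ≤ R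
  subG : HasSubgaussianMGF id (σ ^ 2) N
  one_le : 1 ≤ s
  L_pos : 0 < L
  μ_pos : 0 < μ
  μ_le : μ ≤ L
  form : RestrictedForm (covOp DX) s L μ
  sparse : 96 * (L / μ) ^ 2 * l0 θs ≤ s

/-- The excess risk `𝓛(θ) - 𝓛(θ_*)`. -/
noncomputable def excess {d : ℕ} (DX : Measure (E d)) (θs θ : E d) : ℝ :=
  inner ℝ (covOp DX (θ - θs)) (θ - θs)

/-- The batch size `B` is such that one gradient step turns the bound `u` on the `L^p` norm of
the excess risk into `a u + r₁ u + r₂`. -/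
structure GoodBatch (R : ℝ) (σ : ℝ≥0) (s : ℕ) (L μ : ℝ) (p B : ℕ) (r₁ r₂ : ℝ) : Prop where
  pos : 0 < B
  rel : 12 * Real.exp 1 ^ 2 * p * s / (L * B) * (32 * s * R ^ 4 / μ) ≤ r₁
  add : 12 * Real.exp 1 ^ 2 * p * s / (L * B) * (8 * σ ^ 2 * R ^ 2) ≤ r₂

namespace SparseModel

variable {d : ℕ} {DX : Measure (E d)} {N : Measure ℝ} {θs : E d} {R : ℝ} {σ : ℝ≥0} {s : ℕ}
  {L μ : ℝ}

lemma one_le_kappa (M : SparseModel DX N θs R σ s L μ) : 1 ≤ L / μ := by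
  rw [le_div_iff₀ M.μ_pos, one_mul]; exact M.μ_le

lemma l0_le (M : SparseModel DX N θs R σ s L μ) : l0 θs ≤ s := by
  have h1 : (l0 θs : ℝ) ≤ 96 * (L / μ) ^ 2 * l0 θs :=
    le_mul_of_one_le_left (by positivity) (by nlinarith [one_le_pow₀ M.one_le_kappa (n := 2)])
  exact_mod_cast h1.trans M.sparse

lemma excess_nonneg (M : SparseModel DX N θs R σ s L μ) (θ : E d) : 0 ≤ excess DX θs θ :=
  M.form.nonneg _

/-- The support of `θ_*` is identified once the excess risk is small. -/
lemma supp_subset (M : SparseModel DX N θs R σ s L μ) {θ : E d} (hθ : l0 θ ≤ s)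
    (h : excess DX θs θ < μ / 2 * rMin θs ^ 2) : supp θs ⊆ supp θ := by
  intro j hj
  by_contra hjθ
  have h1 := M.form.lower (θ - θs) ((l0_sub_le _ _).trans (by have := M.l0_le; omega))
  have h2 : rMin θs ≤ |θs j| := csInf_le ⟨0, by rintro _ ⟨i, -, rfl⟩; exact abs_nonneg _⟩
    ⟨j, mem_supp.1 hj, rfl⟩
  have h0 : 0 ≤ rMin θs := Real.sInf_nonneg (by rintro _ ⟨i, -, rfl⟩; exact abs_nonneg _)
  -- A missed coordinate alone contributes `(θs j)² ≥ rMin θs ^ 2` to the squared distance.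
  have h3 : θs j ^ 2 ≤ ‖θ - θs‖ ^ 2 := by
    rw [norm_sq_eq_sum]
    refine le_trans (le_of_eq ?_) (Finset.single_le_sum (f := fun i => (θ - θs) i ^ 2)
      (fun i _ => sq_nonneg _) (Finset.mem_univ j))
    have : θ j = 0 := by
      by_contra hne
      exact hjθ (mem_supp.2 hne)
    simp [this]
  have h4 : rMin θs ^ 2 ≤ θs j ^ 2 := by
    rw [← sq_abs (θs j)]; exact pow_le_pow_left₀ h0 h2 2
  have h5 : μ / 2 * rMin θs ^ 2 ≤ μ / 2 * ‖θ - θs‖ ^ 2 := by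
    exact mul_le_mul_of_nonneg_left (h4.trans h3) (by have := M.μ_pos; positivity)
  exact absurd h (not_lt.2 (h5.trans h1))

lemma measurable_excess {Ω : Type*} [MeasurableSpace Ω] {θ : Ω → E d} (hθ : Measurable θ) :
    Measurable fun ω => excess DX θs (θ ω) :=
  Measurable.comp (g := fun θ : E d => inner ℝ (covOp DX (θ - θs)) (θ - θs))
    (measurable_form θs) hθ

variable [IsProbabilityMeasure DX] [IsProbabilityMeasure N]
  {Ω : Type*} [mΩ : MeasurableSpace Ω] {P : Measure Ω} [IsProbabilityMeasure P]

/-- The exploration phase in `L^p`. -/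
lemma exploration_bound (M : SparseModel DX N θs R σ s L μ) {H : E d → E d}
    (hH : IsHardThresholding s H) {m : ℕ → MeasurableSpace Ω} (hm : ∀ t, m t ≤ mΩ)
    (hmono : Monotone m) {θ₀ : Ω → E d} (hθ₀ : Measurable[m 0] θ₀)
    {z : ℕ → ℕ → ℕ → Ω → E d × ℝ} (hzm : ∀ t i b, Measurable[m t] (z t i b))
    (hz : ∀ t i, FreshBatch (m t) (modelLaw DX N θs) P (z (t + 1) i))
    {B : ℕ → ℕ} {T p : ℕ} {r₁ r₂ : ℝ} (hp : 1 ≤ p) (hdp : (d : ℝ) ≤ Real.exp p)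
    (hB : ∀ t < T, GoodBatch R σ s L μ p (B (t + 1)) r₁ r₂) {v : ℕ → ℝ} (hv0 : ∀ t, 0 ≤ v t)
    (hv : ∀ t < T, (1 - 1 / (8 * (L / μ))) * v t + r₁ * v t + r₂ ≤ v (t + 1)) {len : ℕ}
    (h0 : eLpNorm (fun ω => excess DX θs (H (θ₀ ω))) p P ≤ ENNReal.ofReal (v 0)) {t : ℕ}
    (ht : t ≤ T) :
    Measurable[m t] (fun ω => exploration H (1 / 2 / L) len B (fun t i b => z t i b ω) (θ₀ ω) t) ∧
    eLpNorm (fun ω => excess DX θs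
      (exploration H (1 / 2 / L) len B (fun t i b => z t i b ω) (θ₀ ω) t)) p P ≤
      ENNReal.ofReal (v t) := by
  induction t with
  | zero => exact ⟨hH.measurable.comp hθ₀, h0⟩
  | succ t ih =>
    obtain ⟨ih1, ih2⟩ := ih (by omega)
    have hb := hB t (by omega)
    constructor
    · have hmt : m t ≤ m (t + 1) := hmono (Nat.le_succ t)
      have h1 := ih1.mono hmt le_rfl
      have h2 := @measurable_explorationGrad d Ω (m (t + 1)) _ h1 _
        (fun i b => hzm (t + 1) i b) len (B (t + 1))
      exact hH.measurable.comp (@measurable_sub_smul _ _ (m (t + 1)) _ _ h1 h2 (1 / 2 / L))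
    · refine le_trans ?_ (ENNReal.ofReal_le_ofReal (hv t (by omega)))
      refine eLpNorm_exploration_step_le M.bound M.subG M.one_le M.L_pos M.μ_pos M.μ_le M.form
        M.sparse hH (hm t) ih1 (fun ω => ?_) (hz t) hb.pos hp hdp (hv0 t) hb.rel hb.add ih2
      cases t <;> exact hH.sparse _

/-- The exploitation phase in `L^p`. -/
lemma exploitation_bound (M : SparseModel DX N θs R σ s L μ)
    {m : ℕ → MeasurableSpace Ω} (hm : ∀ t, m t ≤ mΩ)
    (hmono : Monotone m) {θ₀ : Ω → E d} (hθ₀ : Measurable[m 0] θ₀) (hs : ∀ ω, l0 (θ₀ ω) ≤ s)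
    {z : ℕ → ℕ → Ω → E d × ℝ} (hzm : ∀ t b, Measurable[m t] (z t b))
    (hz : ∀ t, FreshBatch (m t) (modelLaw DX N θs) P (z (t + 1)))
    {B : ℕ → ℕ} {T p : ℕ} {a r₁ r₂ : ℝ} (hp : 1 ≤ p) (hdp : (d : ℝ) ≤ Real.exp p)
    (ha : a = 1 ∨ a = 1 - 1 / (2 * (L / μ)) ∧ ∀ ω, supp θs ⊆ supp (θ₀ ω))
    (hB : ∀ t < T, GoodBatch R σ s L μ p (B (t + 1)) r₁ r₂) {v : ℕ → ℝ} (hv0 : ∀ t, 0 ≤ v t)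
    (hv : ∀ t < T, a * v t + r₁ * v t + r₂ ≤ v (t + 1))
    (h0 : eLpNorm (fun ω => excess DX θs (θ₀ ω)) p P ≤ ENNReal.ofReal (v 0)) {t : ℕ}
    (ht : t ≤ T) :
    Measurable[m t] (fun ω => exploitation (1 / 2 / L) B (fun t b => z t b ω) (θ₀ ω) t) ∧
    eLpNorm (fun ω => excess DX θs
      (exploitation (1 / 2 / L) B (fun t b => z t b ω) (θ₀ ω) t)) p P ≤
      ENNReal.ofReal (v t) := by
  induction t with
  | zero => exact ⟨hθ₀, h0⟩
  | succ t ih =>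
    obtain ⟨ih1, ih2⟩ := ih (by omega)
    have hb := hB t (by omega)
    constructor
    · have hmt : m t ≤ m (t + 1) := hmono (Nat.le_succ t)
      have h1 := ih1.mono hmt le_rfl
      have h2 := @measurable_exploitationGrad d Ω (m (t + 1)) _ _
        (hθ₀.mono (hmono (Nat.zero_le _)) le_rfl) h1
        (fun ω => supp_exploitation_subset _ _ _ _ _) _ (fun b => hzm (t + 1) b) (B (t + 1))
      exact @measurable_sub_smul _ _ (m (t + 1)) _ _ h1 h2 (1 / 2 / L)
    · refine le_trans ?_ (ENNReal.ofReal_le_ofReal (hv t (by omega)))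
      exact eLpNorm_exploitation_step_le M.bound M.subG M.L_pos M.μ_pos M.μ_le M.form
        M.l0_le (hm t) ih1 hs (fun ω => supp_exploitation_subset _ _ _ _ _) (hz t) hb.pos hp hdp
        ha (hv0 t) hb.rel hb.add ih2

end SparseModel

/-! ### The examples already used, and freshness of the next batch -/

section Past

variable {α ι Ω : Type*} [MeasurableSpace α]

/-- The σ-algebra generated by the examples with labels in `A`. -/
@[reducible] def sigmaOf (Z : ι → Ω → α) (A : Set ι) : MeasurableSpace Ω :=
  ⨆ i ∈ A, MeasurableSpace.comap (Z i) inferInstance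

lemma sigmaOf_mono (Z : ι → Ω → α) {A A' : Set ι} (h : A ⊆ A') : sigmaOf Z A ≤ sigmaOf Z A' :=
  biSup_mono h

lemma measurable_sigmaOf (Z : ι → Ω → α) {A : Set ι} {i : ι} (hi : i ∈ A) :
    Measurable[sigmaOf Z A] (Z i) := by
  rw [measurable_iff_comap_le]
  exact le_biSup (fun i => MeasurableSpace.comap (Z i) inferInstance) hi

variable [mΩ : MeasurableSpace Ω] {P : Measure Ω} {D : Measure α}

lemma sigmaOf_le {Z : ι → Ω → α} (hZ : ∀ i, Measurable (Z i)) (A : Set ι) :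
    sigmaOf Z A ≤ mΩ :=
  iSup₂_le fun i _ => (hZ i).comap_le

/-- Disjoint subfamilies of an independent family generate independent σ-algebras, and injectivity
of `f` keeps the batch itself independent. -/
lemma freshBatch_sigmaOf {Z : ι → Ω → α} (hZ : ∀ i, Measurable (Z i))
    (hlaw : ∀ i, P.map (Z i) = D) (hind : iIndepFun Z P) {A : Set ι} {f : ℕ → ι}
    (hf : Function.Injective f) (hA : ∀ b, f b ∉ A) :
    FreshBatch (sigmaOf Z A) D P fun b => Z (f b) where
  meas b := hZ _
  law b := hlaw _
  iIndep := hind.precomp hf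
  indep := by
    have := indep_iSup_of_disjoint (fun i => (hZ i).comap_le) hind.iIndep
      (S := A) (T := Set.range f) (Set.disjoint_left.2 (by
        rintro _ hi ⟨b, rfl⟩; exact hA b hi))
    rwa [iSup_range] at this

end Past

section Labels

/-- The labels in use until step `t` of the exploration in round `k`. -/
def exploredUntil (k t : ℕ) : Set SampleIdx :=
  {i | match i with
    | .explore k' t' _ _ => k' < k ∨ k' = k ∧ t' ≤ t
    | .exploit k' _ _ => k' < k}

/-- The labels in use until step `t` of the exploitation in round `k`. -/
def exploitedUntil (k t : ℕ) : Set SampleIdx :=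
  {i | match i with
    | .explore k' _ _ _ => k' ≤ k
    | .exploit k' t' _ => k' < k ∨ k' = k ∧ t' ≤ t}

lemma exploredUntil_mono (k : ℕ) : Monotone (exploredUntil k) := by
  intro t t' h i
  cases i <;> simp only [exploredUntil, Set.mem_ofPred_eq] <;> omega

lemma exploitedUntil_mono (k : ℕ) : Monotone (exploitedUntil k) := by
  intro t t' h i
  cases i <;> simp only [exploitedUntil, Set.mem_ofPred_eq] <;> omega

lemma exploredUntil_subset_exploitedUntil (k t t' : ℕ) :
    exploredUntil k t ⊆ exploitedUntil k t' := by
  intro i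
  cases i <;> simp only [exploredUntil, exploitedUntil, Set.mem_ofPred_eq] <;> omega

/-- With the preceding inclusions this orders the label sets along the run, so the output of each
phase is measurable with respect to the past of the next. -/
lemma exploitedUntil_subset_exploredUntil_succ (k t t' : ℕ) :
    exploitedUntil k t ⊆ exploredUntil (k + 1) t' := by
  intro i
  cases i <;> simp only [exploredUntil, exploitedUntil, Set.mem_ofPred_eq] <;> omega

end Labels

/-! ### Numerical verification of the batch sizes -/

section Batch

/-- The batch sizes of the theorem make the gradient noise negligible. -/
lemma goodBatch_of_floor_le {R L μ α gap Λ : ℝ} {σ : ℝ≥0} {s k T p B : ℕ} (hL : 0 < L)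
    (hμ : 0 < μ) (hR : μ / 2 ≤ R ^ 2) (hs : 1 ≤ s) (hα : α = 1 / 64 / (L / μ)) (hα1 : α < 1)
    (hgap : 0 < gap) (hΛ : 1 ≤ Λ) (hp : (p : ℝ) ≤ 3 * Λ) (hT : 1 ≤ T)
    (hB : ⌊(10 : ℝ) ^ 8 * Λ * batchScale L μ R σ gap α s k T⌋₊ ≤ B) :
    GoodBatch R σ s L μ p B (α / 10 / T) (α / 10 * ((1 - α) ^ k * gap * (1 - α) ^ T) / T) := by
  have hα0 : 0 < α := by rw [hα]; positivity
  have h1α : 0 < 1 - α := by linarith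
  have hsR : (1 : ℝ) ≤ s := by exact_mod_cast hs
  have hTR : (1 : ℝ) ≤ T := by exact_mod_cast hT
  have hs2 : (1 : ℝ) ≤ (s : ℝ) ^ 2 := one_le_pow₀ hsR
  have hR4 : μ ^ 2 / 4 ≤ R ^ 4 := by
    have := pow_le_pow_left₀ (by positivity) hR 2
    calc μ ^ 2 / 4 = (μ / 2) ^ 2 := by ring
      _ ≤ (R ^ 2) ^ 2 := this
      _ = R ^ 4 := by ring
  have hR4' : 0 < R ^ 4 := lt_of_lt_of_le (by positivity) hR4
  obtain ⟨Q, hQ⟩ : ∃ Q : ℝ, Q = (1 - α) ^ k * gap * (1 - α) ^ T := ⟨_, rfl⟩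
  have hQ0 : 0 < Q := by rw [hQ]; positivity
  have hX1 : R ^ 4 / μ ^ 2 * T * (s : ℝ) ^ 2 ≤ batchScale L μ R σ gap α s k T := by
    refine le_trans (le_of_eq ?_) (le_max_left _ _)
    field_simp
  have hX2 : σ ^ 2 * R ^ 2 * T * s / (α * L * Q) ≤ batchScale L μ R σ gap α s k T := by
    refine le_trans (le_of_eq ?_) (le_max_right _ _)
    rw [hQ]; field_simp
  have hquarter : 1 / 4 ≤ batchScale L μ R σ gap α s k T := by
    refine le_trans ?_ hX1
    have h1 : 1 / 4 ≤ R ^ 4 / μ ^ 2 := by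
      rw [le_div_iff₀ (by positivity)]; linarith
    calc (1 / 4 : ℝ) = 1 / 4 * 1 * 1 := by norm_num
      _ ≤ R ^ 4 / μ ^ 2 * T * (s : ℝ) ^ 2 := by gcongr
  obtain ⟨X, hX⟩ : ∃ X : ℝ, X = batchScale L μ R σ gap α s k T := ⟨_, rfl⟩
  rw [← hX] at hX1 hX2 hquarter hB
  -- As `Λ * X ≥ 1/4`, rounding down loses far less than half of `10 ^ 8 * Λ * X`.
  have hBX : 10 ^ 8 / 2 * Λ * X ≤ B := by
    have h1 : (10 : ℝ) ^ 8 * Λ * X - 1 ≤ B :=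
      (Nat.sub_one_lt_floor _).le.trans (by exact_mod_cast hB)
    have h2 : 1 * (1 / 4) ≤ Λ * X := mul_le_mul hΛ hquarter (by norm_num) (by linarith)
    linarith
  have hB0 : (0 : ℝ) < B := lt_of_lt_of_le (by positivity) hBX
  have he : Real.exp 1 ^ 2 ≤ 7.4 := by
    have h1 := Real.exp_one_lt_d9
    have h2 := pow_le_pow_left₀ (Real.exp_pos 1).le h1.le 2
    norm_num at h2 ⊢
    linarith
  have hpe : Real.exp 1 ^ 2 * p ≤ 22.2 * Λ := by
    calc Real.exp 1 ^ 2 * p ≤ 7.4 * (3 * Λ) := by gcongr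
      _ = _ := by ring
  refine ⟨by exact_mod_cast hB0, ?_, ?_⟩
  · have hB1 : 10 ^ 8 / 2 * Λ * (R ^ 4 / μ ^ 2 * T * (s : ℝ) ^ 2) ≤ B := le_trans (by gcongr) hBX
    have e1 : 12 * Real.exp 1 ^ 2 * p * s / (L * B) * (32 * s * R ^ 4 / μ) =
        Real.exp 1 ^ 2 * p * (384 * s ^ 2 * R ^ 4) / (L * B * μ) := by field_simp; ring
    have e2 : α / 10 / T = (B * μ ^ 2 / (640 * T)) / (L * B * μ) := by rw [hα]; field_simp; ring
    rw [e1, e2]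
    gcongr
    rw [le_div_iff₀ (by positivity)]
    calc Real.exp 1 ^ 2 * p * (384 * s ^ 2 * R ^ 4) * (640 * T)
        ≤ 22.2 * Λ * (384 * s ^ 2 * R ^ 4) * (640 * T) := by gcongr
      _ = 5455872 * (Λ * s ^ 2 * R ^ 4 * T) := by ring
      _ ≤ 10 ^ 8 / 2 * (Λ * s ^ 2 * R ^ 4 * T) := by gcongr; norm_num
      _ = 10 ^ 8 / 2 * Λ * (R ^ 4 / μ ^ 2 * T * (s : ℝ) ^ 2) * μ ^ 2 := by field_simp
      _ ≤ B * μ ^ 2 := by gcongr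
  · have hB2 : 10 ^ 8 / 2 * Λ * (σ ^ 2 * R ^ 2 * T * s / (α * L * Q)) ≤ B :=
      le_trans (by gcongr) hBX
    rw [← hQ]
    have e1 : 12 * Real.exp 1 ^ 2 * p * s / (L * B) * (8 * σ ^ 2 * R ^ 2) =
        Real.exp 1 ^ 2 * p * (96 * s * σ ^ 2 * R ^ 2) / (L * B) := by field_simp; ring
    have e2 : α / 10 * Q / T = (B * (α * L * Q) / (10 * T)) / (L * B) := by field_simp
    rw [e1, e2]
    gcongr
    rw [le_div_iff₀ (by positivity)]
    calc Real.exp 1 ^ 2 * p * (96 * s * σ ^ 2 * R ^ 2) * (10 * T)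
        ≤ 22.2 * Λ * (96 * s * σ ^ 2 * R ^ 2) * (10 * T) := by gcongr
      _ = 21312 * (Λ * s * σ ^ 2 * R ^ 2 * T) := by ring
      _ ≤ 10 ^ 8 / 2 * (Λ * s * σ ^ 2 * R ^ 2 * T) := by gcongr; norm_num
      _ = 10 ^ 8 / 2 * Λ * (σ ^ 2 * R ^ 2 * T * s / (α * L * Q)) * (α * L * Q) := by field_simp
      _ ≤ B * (α * L * Q) := by gcongr

end Batch

/-! ### From moments to probabilities -/

section Markov

variable {Ω : Type*} [MeasurableSpace Ω] {P : Measure Ω}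

/-- Markov's inequality for the `p`-th power: a margin of a factor `2` over the `L^p` norm is
exceeded with probability at most `2^{-p}`. -/
lemma measureReal_two_mul_le {G : Ω → ℝ} (hG : Measurable G) {p : ℕ}
    (hp : 1 ≤ p) {x : ℝ} (hx : 0 < x) (h : eLpNorm G p P ≤ ENNReal.ofReal x) :
    P.real {ω | 2 * x ≤ G ω} ≤ (1 / 2) ^ p := by
  have h1 := meas_ge_le_mul_pow_eLpNorm_enorm P (p := (p : ENNReal)) (by simp; omega) (by simp)
    hG.aestronglyMeasurable (ε := ENNReal.ofReal (2 * x)) (by simpa using hx)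
    (by simp)
  have h2 : {ω | 2 * x ≤ G ω} ⊆ {ω | ENNReal.ofReal (2 * x) ≤ ‖G ω‖ₑ} := by
    intro ω hω
    have hω' : 2 * x ≤ G ω := hω
    show ENNReal.ofReal (2 * x) ≤ ‖G ω‖ₑ
    rw [Real.enorm_eq_ofReal_abs]
    exact ENNReal.ofReal_le_ofReal (hω'.trans (le_abs_self _))
  have h3 : P {ω | 2 * x ≤ G ω} ≤ ENNReal.ofReal ((1 / 2) ^ p) := by
    refine (measure_mono h2).trans (h1.trans ?_)
    simp only [ENNReal.toReal_natCast, ENNReal.rpow_natCast]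
    rw [← mul_pow, ENNReal.ofReal_pow (by norm_num)]
    refine pow_le_pow_left₀ (by positivity) ?_ p
    rw [← ENNReal.ofReal_inv_of_pos (by positivity)]
    refine (mul_le_mul_right h _).trans ?_
    rw [← ENNReal.ofReal_mul (by positivity)]
    refine ENNReal.ofReal_le_ofReal (le_of_eq ?_)
    field_simp
  exact ENNReal.toReal_le_of_le_ofReal (by positivity) h3

lemma one_sub_le_measureReal [IsProbabilityMeasure P] {A B : Set Ω} {δ : ℝ} (hAB : Aᶜ ⊆ B)
    (hB : P.real B ≤ δ) :
    1 - δ ≤ P.real A := by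
  have h1 : P.real Set.univ ≤ P.real A + P.real B :=
    (measureReal_mono (fun ω _ => by
      by_cases h : ω ∈ A
      · exact Or.inl h
      · exact Or.inr (hAB h))).trans (measureReal_union_le A B)
  rw [probReal_univ] at h1
  linarith

end Markov

/-! ### Rounds of the algorithm -/

namespace SparseModel

variable {d : ℕ} {DX : Measure (E d)} {N : Measure ℝ} {θs : E d} {R : ℝ} {σ : ℝ≥0} {s : ℕ}
  {L μ : ℝ} [IsProbabilityMeasure DX] [IsProbabilityMeasure N]
  {Ω : Type*} [mΩ : MeasurableSpace Ω] {P : Measure Ω} [IsProbabilityMeasure P]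
  {Z : SampleIdx → Ω → E d × ℝ}

/-- In terms of `α` the contraction rate is `8α`, and the noise costs at most `α/30 + α/10`, so the
first step already achieves `1 - 6α`. The later steps need only preserve this level. -/
lemma exploration_round (M : SparseModel DX N θs R σ s L μ) {H : E d → E d}
    (hH : IsHardThresholding s H) (hZ : ∀ i, Measurable (Z i))
    (hlaw : ∀ i, P.map (Z i) = modelLaw DX N θs) (hind : iIndepFun Z P)
    {α u r₂ : ℝ} (hα : α = 1 / 64 / (L / μ)) (hu : 0 ≤ u) {p : ℕ} (hp : 1 ≤ p)
    (hdp : (d : ℝ) ≤ Real.exp p) {k len : ℕ} {B : ℕ → ℕ}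
    (hB : ∀ t < 3, GoodBatch R σ s L μ p (B (t + 1)) (α / 10 / 3) r₂) (hr₂ : r₂ ≤ α / 10 * u)
    {θ : Ω → E d} (hθ : Measurable[sigmaOf Z (exploredUntil (k + 1) 0)] θ)
    (hθu : eLpNorm (fun ω => excess DX θs (H (θ ω))) p P ≤ ENNReal.ofReal u) :
    Measurable[sigmaOf Z (exploredUntil (k + 1) 3)] (fun ω => exploration H (1 / 2 / L) len B
      (fun t i b => Z (.explore (k + 1) t i b) ω) (θ ω) 3) ∧
    eLpNorm (fun ω => excess DX θs (exploration H (1 / 2 / L) len B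
      (fun t i b => Z (.explore (k + 1) t i b) ω) (θ ω) 3)) p P ≤
      ENNReal.ofReal ((1 - 6 * α) * u) := by
  have hκ := M.one_le_kappa
  have hα0 : 0 < α := by rw [hα]; positivity
  have hα64 : α ≤ 1 / 64 := by rw [hα]; exact div_le_self (by norm_num) hκ
  have hα8 : 1 / (8 * (L / μ)) = 8 * α := by rw [hα]; field_simp; ring
  have hw : 0 ≤ (1 - 6 * α) * u := mul_nonneg (by linarith) hu
  refine M.exploration_bound hH (m := fun t => sigmaOf Z (exploredUntil (k + 1) t))
    (fun t => sigmaOf_le hZ _) (fun t t' h => sigmaOf_mono Z (exploredUntil_mono _ h)) hθ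
    (z := fun t i b => Z (.explore (k + 1) t i b))
    (fun t i b => measurable_sigmaOf Z (by simp [exploredUntil]))
    (fun t i => freshBatch_sigmaOf hZ hlaw hind (f := fun b => .explore (k + 1) (t + 1) i b)
      (fun b b' h => by simpa using h) (fun b => by simp [exploredUntil])) hp hdp hB
    (v := fun t => if t = 0 then u else (1 - 6 * α) * u) (fun t => ?_) (fun t _ => ?_)
    hθu le_rfl
  · split_ifs <;> assumption
  · rw [hα8]
    have hαu : 0 ≤ α * u := by positivity
    simp only [Nat.succ_ne_zero, if_false]
    split_ifs
    · linarith
    · have h1 : α * (α * u) ≤ 1 / 64 * (α * u) := by gcongr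
      have h2 : (1 - 8 * α) * ((1 - 6 * α) * u) + α / 10 / 3 * ((1 - 6 * α) * u) =
        (1 - 6 * α) * u - (8 - 1 / 30) * (α * u) + 6 * (8 - 1 / 30) * (α * (α * u)) := by ring
      linarith

/-- The noise allowance is split evenly over the `T` steps, so that it sums to at most `α` times the
relevant level. The two conclusions come from two majorants for the same run: one that grows
linearly on any support, and one that decays geometrically once the support is right. -/
lemma exploitation_round (M : SparseModel DX N θs R σ s L μ) (hZ : ∀ i, Measurable (Z i))
    (hlaw : ∀ i, P.map (Z i) = modelLaw DX N θs) (hind : iIndepFun Z P)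
    {α u : ℝ} (hα : α = 1 / 64 / (L / μ)) (hu : 0 ≤ u) {p : ℕ} (hp : 1 ≤ p)
    (hdp : (d : ℝ) ≤ Real.exp p) {k T : ℕ} {B : ℕ → ℕ} {r₂ : ℝ}
    (hB : ∀ t < T, GoodBatch R σ s L μ p (B (t + 1)) (α / 10 / T) r₂)
    (hr₂ : r₂ ≤ α / 10 * (u * (1 - α) ^ T) / T)
    {θ : Ω → E d} (hθ : Measurable[sigmaOf Z (exploitedUntil (k + 1) 0)] θ)
    (hs : ∀ ω, l0 (θ ω) ≤ s)
    (hθu : eLpNorm (fun ω => excess DX θs (θ ω)) p P ≤ ENNReal.ofReal ((1 - 6 * α) * u)) :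
    Measurable[sigmaOf Z (exploitedUntil (k + 1) T)] (fun ω => exploitation (1 / 2 / L) B
      (fun t b => Z (.exploit (k + 1) t b) ω) (θ ω) T) ∧
    eLpNorm (fun ω => excess DX θs (exploitation (1 / 2 / L) B
      (fun t b => Z (.exploit (k + 1) t b) ω) (θ ω) T)) p P ≤ ENNReal.ofReal ((1 - α) * u) ∧
    ((∀ ω, supp θs ⊆ supp (θ ω)) →
      eLpNorm (fun ω => excess DX θs (exploitation (1 / 2 / L) B
        (fun t b => Z (.exploit (k + 1) t b) ω) (θ ω) T)) p P ≤
        ENNReal.ofReal ((1 - α) ^ T * ((1 - α) * u))) := by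
  have hκ := M.one_le_kappa
  have hα0 : 0 < α := by rw [hα]; positivity
  have hα64 : α ≤ 1 / 64 := by rw [hα]; exact div_le_self (by norm_num) hκ
  have hα32 : 1 / (2 * (L / μ)) = 32 * α := by rw [hα]; field_simp; ring
  have h1α : 0 < 1 - α := by linarith
  have hTα : (T : ℝ) * (α / T) ≤ α := by
    rcases Nat.eq_zero_or_pos T with rfl | hT
    · simpa using hα0.le
    · exact le_of_eq (by field_simp)
  have htα {t : ℕ} (ht : t < T) : (t : ℝ) * (α / T) ≤ α :=
    le_trans (by gcongr) hTα
  have hpowT : (1 - α) ^ T ≤ 1 := pow_le_one₀ h1α.le (by linarith)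
  have h6 : 0 < 1 - 6 * α := by linarith
  have key := fun (a : ℝ) ha (v : ℕ → ℝ) hv0 hv h0 =>
    M.exploitation_bound (m := fun t => sigmaOf Z (exploitedUntil (k + 1) t))
    (fun t => sigmaOf_le hZ _) (fun t t' h => sigmaOf_mono Z (exploitedUntil_mono _ h)) hθ hs
    (z := fun t b => Z (.exploit (k + 1) t b))
    (fun t b => measurable_sigmaOf Z (by simp [exploitedUntil]))
    (fun t => freshBatch_sigmaOf hZ hlaw hind (f := fun b => .exploit (k + 1) (t + 1) b)
      (fun b b' h => by simpa using h) (fun b => by simp [exploitedUntil])) (a := a)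
      hp hdp ha hB (v := v) hv0 hv h0 (le_refl T)
  have gen := key 1 (Or.inl rfl) (fun t => (1 - 6 * α + t * (α / T)) * u)
    (fun t => by positivity) (fun t ht => ?_) ?_
  · refine ⟨gen.1, gen.2.trans (ENNReal.ofReal_le_ofReal ?_), fun hid => ?_⟩
    · gcongr; linarith
    -- The actual rate is `32α`, of which the majorant uses only `α`; part of the rest absorbs the
    -- relative noise. The additive noise is already scaled to the final level `(1 - α) ^ T`, so its
    -- accumulation leaves a factor `1 - 5α`.
    · have hid' := key (1 - 1 / (2 * (L / μ))) (Or.inr ⟨rfl, hid⟩)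
        (fun t => ((1 - α) ^ t * (1 - 6 * α) + t * (α / T) * (1 - α) ^ T) * u)
        (fun t => by positivity) (fun t ht => ?_) ?_
      · refine hid'.2.trans (ENNReal.ofReal_le_ofReal ?_)
        have h1 : (T : ℝ) * (α / T) * (1 - α) ^ T ≤ α * (1 - α) ^ T := by gcongr
        calc ((1 - α) ^ T * (1 - 6 * α) + T * (α / T) * (1 - α) ^ T) * u
            ≤ ((1 - α) ^ T * (1 - 6 * α) + α * (1 - α) ^ T) * u := by gcongr
          _ = (1 - α) ^ T * ((1 - 5 * α) * u) := by ring
          _ ≤ (1 - α) ^ T * ((1 - α) * u) := by gcongr; linarith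
      · rw [hα32]
        have hT : (1 : ℝ) ≤ T := by exact_mod_cast (by omega : 1 ≤ T)
        obtain ⟨x, hx⟩ : ∃ x : ℝ,
          x = ((1 - α) ^ t * (1 - 6 * α) + t * (α / T) * (1 - α) ^ T) * u := ⟨_, rfl⟩
        have hx0 : 0 ≤ x := by rw [hx]; positivity
        have h1 : α / 10 / T * x ≤ α * x := by
          gcongr
          rw [div_div]; exact div_le_self hα0.le (by linarith)
        have h2 : r₂ ≤ α / T * ((1 - α) ^ T * u) := by
          refine hr₂.trans ?_
          have : 0 ≤ α / T * ((1 - α) ^ T * u) := by positivity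
          calc α / 10 * (u * (1 - α) ^ T) / T = 1 / 10 * (α / T * ((1 - α) ^ T * u)) := by ring
            _ ≤ _ := by linarith
        have h3 : 0 ≤ α * x := by positivity
        have h4 : (1 - α) * x ≤
            ((1 - α) ^ (t + 1) * (1 - 6 * α) + t * (α / T) * (1 - α) ^ T) * u := by
          have h5 : (1 - α) * (t * (α / T) * (1 - α) ^ T * u) ≤ t * (α / T) * (1 - α) ^ T * u :=
            mul_le_of_le_one_left (by positivity) (by linarith)
          rw [hx, pow_succ]
          linarith
        simp only [← hx]
        push_cast
        linarith
      · simpa using hθu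
  · have hT : (1 : ℝ) ≤ T := by exact_mod_cast (by omega : 1 ≤ T)
    have h1 : α / 10 / T * ((1 - 6 * α + t * (α / T)) * u) ≤ α / 10 / T * u := by
      gcongr
      refine mul_le_of_le_one_left hu ?_
      have := htα ht
      linarith
    have h2 : r₂ ≤ α / 10 / T * u := by
      refine hr₂.trans ?_
      calc α / 10 * (u * (1 - α) ^ T) / T = α / 10 / T * (u * (1 - α) ^ T) := by ring
        _ ≤ α / 10 / T * (u * 1) := by gcongr
        _ = _ := by ring
    have h3 : 0 ≤ α / T * u := by positivity
    have h4 : α / 10 / T * u = 1 / 10 * (α / T * u) := by ring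
    push_cast
    linarith
  · simpa using hθu

end SparseModel

namespace SparseModel

variable {d : ℕ} {DX : Measure (E d)} {N : Measure ℝ} {θs : E d} {R : ℝ} {σ : ℝ≥0} {s : ℕ}
  {L μ : ℝ} [IsProbabilityMeasure DX] [IsProbabilityMeasure N]
  {Ω : Type*} [mΩ : MeasurableSpace Ω] {P : Measure Ω} [IsProbabilityMeasure P]
  {Z : SampleIdx → Ω → E d × ℝ}

/-- One round of the algorithm in `L^p`: the result of the exploration, the result of the
exploitation, and the result of the exploitation from any other starting point. -/
lemma hybrid_round (M : SparseModel DX N θs R σ s L μ) {H : E d → E d}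
    (hH : IsHardThresholding s H) (hZ : ∀ i, Measurable (Z i))
    (hlaw : ∀ i, P.map (Z i) = modelLaw DX N θs) (hind : iIndepFun Z P)
    {α gap : ℝ} (hα : α = 1 / 64 / (L / μ)) (hgap : 0 < gap) {p : ℕ} (hp : 1 ≤ p)
    (hdp : (d : ℝ) ≤ Real.exp p) {T s' : ℕ} {Bm B : ℕ → ℕ → ℕ}
    (hBm : ∀ k, ∀ t < 3, GoodBatch R σ s L μ p (Bm (t + 1) (k + 1)) (α / 10 / (3 : ℕ))
      (α / 10 * ((1 - α) ^ (k + 1) * gap * (1 - α) ^ 3) / (3 : ℕ)))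
    (hB : ∀ k, ∀ t < T, GoodBatch R σ s L μ p (B (t + 1) (k + 1)) (α / 10 / T)
      (α / 10 * ((1 - α) ^ (k + 1) * gap * (1 - α) ^ T) / T))
    {θ₀ : E d} (h0 : excess DX θs (H θ₀) = gap) (k : ℕ) :
    (Measurable[sigmaOf Z (exploitedUntil k T)] fun ω =>
      hybrid H (1 / 2 / L) s' s Bm B (fun _ => 3) (fun _ => T) (fun i => Z i ω) θ₀ k) ∧
    eLpNorm (fun ω => excess DX θs (H (hybrid H (1 / 2 / L) s' s Bm B (fun _ => 3) (fun _ => T)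
      (fun i => Z i ω) θ₀ k))) p P ≤ ENNReal.ofReal ((1 - α) ^ k * gap) ∧
    (Measurable[sigmaOf Z (exploredUntil (k + 1) 3)] fun ω =>
      exploration H (1 / 2 / L) (s' - s) (fun t => Bm t (k + 1))
        (fun t i b => Z (.explore (k + 1) t i b) ω)
        (hybrid H (1 / 2 / L) s' s Bm B (fun _ => 3) (fun _ => T) (fun i => Z i ω) θ₀ k) 3) ∧
    eLpNorm (fun ω => excess DX θs (exploration H (1 / 2 / L) (s' - s) (fun t => Bm t (k + 1))
        (fun t i b => Z (.explore (k + 1) t i b) ω)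
        (hybrid H (1 / 2 / L) s' s Bm B (fun _ => 3) (fun _ => T) (fun i => Z i ω) θ₀ k) 3)) p P
      ≤ ENNReal.ofReal ((1 - 6 * α) * ((1 - α) ^ k * gap)) ∧
    ∀ θ : Ω → E d, Measurable[sigmaOf Z (exploitedUntil (k + 1) 0)] θ → (∀ ω, l0 (θ ω) ≤ s) →
      eLpNorm (fun ω => excess DX θs (θ ω)) p P ≤
        ENNReal.ofReal ((1 - 6 * α) * ((1 - α) ^ k * gap)) →
      Measurable[sigmaOf Z (exploitedUntil (k + 1) T)] (fun ω => exploitation (1 / 2 / L)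
        (fun t => B t (k + 1)) (fun t b => Z (.exploit (k + 1) t b) ω) (θ ω) T) ∧
      eLpNorm (fun ω => excess DX θs (exploitation (1 / 2 / L) (fun t => B t (k + 1))
        (fun t b => Z (.exploit (k + 1) t b) ω) (θ ω) T)) p P ≤
        ENNReal.ofReal ((1 - α) ^ (k + 1) * gap) ∧
      ((∀ ω, supp θs ⊆ supp (θ ω)) →
        eLpNorm (fun ω => excess DX θs (exploitation (1 / 2 / L) (fun t => B t (k + 1))
          (fun t b => Z (.exploit (k + 1) t b) ω) (θ ω) T)) p P ≤
          ENNReal.ofReal ((1 - α) ^ (k + 1 + T) * gap)) := by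
  have hκ := M.one_le_kappa
  have hα0 : 0 < α := by rw [hα]; positivity
  have hα64 : α ≤ 1 / 64 := by rw [hα]; exact div_le_self (by norm_num) hκ
  have h1α : 0 < 1 - α := by linarith
  have hexplore (k : ℕ) {θ : Ω → E d} (hθ : Measurable[sigmaOf Z (exploitedUntil k T)] θ)
      (hθu : eLpNorm (fun ω => excess DX θs (H (θ ω))) p P ≤
        ENNReal.ofReal ((1 - α) ^ k * gap)) :=
    M.exploration_round hH hZ hlaw hind hα (by positivity : 0 ≤ (1 - α) ^ k * gap) hp hdp
      (B := fun t => Bm t (k + 1)) (len := s' - s)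
      (r₂ := α / 10 * ((1 - α) ^ (k + 1) * gap * (1 - α) ^ 3) / (3 : ℕ))
      (by simpa using hBm k) (by
        have h3 : (1 - α) ^ 3 ≤ 1 := pow_le_one₀ h1α.le (by linarith)
        calc α / 10 * ((1 - α) ^ (k + 1) * gap * (1 - α) ^ 3) / (3 : ℕ)
            = (1 / 3) * ((1 - α) * (1 - α) ^ 3) * (α / 10 * ((1 - α) ^ k * gap)) := by
              push_cast; ring
          _ ≤ 1 * (α / 10 * ((1 - α) ^ k * gap)) := by
              gcongr
              have : (1 - α) * (1 - α) ^ 3 ≤ 1 * 1 := by gcongr; linarith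
              linarith
          _ = _ := one_mul _)
      (hθ.mono (sigmaOf_mono Z (exploitedUntil_subset_exploredUntil_succ k T 0)) le_rfl) hθu
  have hexploit (k : ℕ) {θ : Ω → E d}
      (hθ : Measurable[sigmaOf Z (exploitedUntil (k + 1) 0)] θ) (hs : ∀ ω, l0 (θ ω) ≤ s)
      (hθu : eLpNorm (fun ω => excess DX θs (θ ω)) p P ≤
        ENNReal.ofReal ((1 - 6 * α) * ((1 - α) ^ k * gap))) :=
    M.exploitation_round hZ hlaw hind hα (by positivity : 0 ≤ (1 - α) ^ k * gap) hp hdp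
      -- The batch sizes of round `k + 1` are tuned to `(1 - α) ^ (k + 1)`, which is below the level
      -- `(1 - α) ^ k` at which the round starts.
      (B := fun t => B t (k + 1)) (hB k) (by
        gcongr ?_ / _
        gcongr ?_ * ?_
        gcongr ?_ * _
        gcongr ?_ * _
        exact pow_le_pow_of_le_one h1α.le (by linarith) (Nat.le_succ k)) hθ hs hθu
  have hstart : (Measurable[sigmaOf Z (exploitedUntil k T)] fun ω =>
      hybrid H (1 / 2 / L) s' s Bm B (fun _ => 3) (fun _ => T) (fun i => Z i ω) θ₀ k) ∧
    eLpNorm (fun ω => excess DX θs (H (hybrid H (1 / 2 / L) s' s Bm B (fun _ => 3) (fun _ => T)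
      (fun i => Z i ω) θ₀ k))) p P ≤ ENNReal.ofReal ((1 - α) ^ k * gap) := by
    induction k with
    | zero =>
      refine ⟨@measurable_const _ _ _ (sigmaOf Z (exploitedUntil 0 T)) θ₀, ?_⟩
      simp only [hybrid, h0, pow_zero, one_mul]
      rw [eLpNorm_const _ (by simp; omega) (IsProbabilityMeasure.ne_zero P)]
      simp [Real.enorm_eq_ofReal hgap.le]
    | succ k ih =>
      obtain ⟨h1, h2⟩ := hexplore k ih.1 ih.2
      obtain ⟨h3, h4, -⟩ := hexploit k
        (h1.mono (sigmaOf_mono Z (exploredUntil_subset_exploitedUntil _ _ _)) le_rfl)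
        (fun ω => hH.sparse _) h2
      refine ⟨h3, ?_⟩
      -- Exploitation keeps the iterate `s`-sparse, so the thresholding that opens the next round
      -- does nothing; only the one applied to `θ₀` can matter, and the gap is measured after it.
      have hsp (ω : Ω) : l0 (hybrid H (1 / 2 / L) s' s Bm B (fun _ => 3) (fun _ => T)
          (fun i => Z i ω) θ₀ (k + 1)) ≤ s :=
        (Finset.card_le_card (supp_exploitation_subset _ _ _ _ _)).trans (hH.sparse _)
      simp only [fun ω => hH.apply_eq_self (hsp ω)]
      rw [pow_succ', mul_assoc]
      exact h4
  obtain ⟨h1, h2⟩ := hexplore k hstart.1 hstart.2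
  refine ⟨hstart.1, hstart.2, h1, h2, fun θ hθ hs hθu => ?_⟩
  obtain ⟨h3, h4, h5⟩ := hexploit k hθ hs hθu
  refine ⟨h3, ?_, fun hid => ?_⟩
  · rwa [pow_succ', mul_assoc]
  · have e : (1 - α) ^ (k + 1 + T) * gap = (1 - α) ^ T * ((1 - α) * ((1 - α) ^ k * gap)) := by
      ring
    rw [e]
    exact h5 hid

/-- The guarantees for the hybrid algorithm with good batch sizes. -/
lemma hybrid_bound (M : SparseModel DX N θs R σ s L μ) {H : E d → E d}
    (hH : IsHardThresholding s H) (hZ : ∀ i, Measurable (Z i))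
    (hlaw : ∀ i, P.map (Z i) = modelLaw DX N θs) (hind : iIndepFun Z P)
    {α gap δ : ℝ} (hα : α = 1 / 64 / (L / μ)) (hgap : 0 < gap) {p : ℕ} (hp : 1 ≤ p)
    (hdp : (d : ℝ) ≤ Real.exp p) (hpδ : (1 / 2) ^ p ≤ δ) {T s' : ℕ} {Bm B : ℕ → ℕ → ℕ}
    (hBm : ∀ k, ∀ t < 3, GoodBatch R σ s L μ p (Bm (t + 1) (k + 1)) (α / 10 / (3 : ℕ))
      (α / 10 * ((1 - α) ^ (k + 1) * gap * (1 - α) ^ 3) / (3 : ℕ)))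
    (hB : ∀ k, ∀ t < T, GoodBatch R σ s L μ p (B (t + 1) (k + 1)) (α / 10 / T)
      (α / 10 * ((1 - α) ^ (k + 1) * gap * (1 - α) ^ T) / T))
    {θ₀ : E d} (h0 : excess DX θs (H θ₀) = gap) {θ : ℕ → Ω → E d}
    (hθ : ∀ k ω, θ k ω =
      hybrid H (1 / 2 / L) s' s Bm B (fun _ => 3) (fun _ => T) (fun i => Z i ω) θ₀ k)
    {K : ℕ} (hK : 1 ≤ K) :
    1 - δ ≤ P.real {ω | excess DX θs (θ K ω) ≤ 2 * (1 - α) ^ K * gap} ∧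
      (2 * ((1 - α) ^ K * gap) ≤ μ / 2 * rMin θs ^ 2 →
        1 - δ ≤ P.real {ω | supp θs ⊆ supp (θ K ω)} ∧
        1 - 2 * δ ≤ P.real {ω | supp θs ⊆ supp (θ K ω) ∧
          excess DX θs (θ K ω) ≤ 2 * (1 - α) ^ (K + T) * gap}) := by
  have hκ := M.one_le_kappa
  have hα0 : 0 < α := by rw [hα]; positivity
  have hα64 : α ≤ 1 / 64 := by rw [hα]; exact div_le_self (by norm_num) hκ
  have h1α : 0 < 1 - α := by linarith
  obtain ⟨k, rfl⟩ : ∃ k, K = k + 1 := ⟨K - 1, by omega⟩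
  obtain ⟨-, -, hmid, hmidu, hend⟩ :=
    M.hybrid_round hH hZ hlaw hind (s' := s') hα hgap hp hdp hBm hB h0 k
  obtain ⟨ϑ, hϑ⟩ : ∃ ϑ : Ω → E d, ϑ = fun ω =>
    exploration H (1 / 2 / L) (s' - s) (fun t => Bm t (k + 1))
      (fun t i b => Z (.explore (k + 1) t i b) ω)
      (hybrid H (1 / 2 / L) s' s Bm B (fun _ => 3) (fun _ => T) (fun i => Z i ω) θ₀ k) 3 :=
    ⟨_, rfl⟩
  have hϑs (ω : Ω) : l0 (ϑ ω) ≤ s := by rw [hϑ]; exact hH.sparse _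
  have hθK (ω : Ω) : θ (k + 1) ω = exploitation (1 / 2 / L) (fun t => B t (k + 1))
      (fun t b => Z (.exploit (k + 1) t b) ω) (ϑ ω) T := by
    rw [hθ, hϑ]; rfl
  have hmid' : Measurable[sigmaOf Z (exploitedUntil (k + 1) 0)] ϑ := by
    rw [hϑ]
    exact hmid.mono (sigmaOf_mono Z (exploredUntil_subset_exploitedUntil _ _ _)) le_rfl
  have hϑu : eLpNorm (fun ω => excess DX θs (ϑ ω)) p P ≤
      ENNReal.ofReal ((1 - 6 * α) * ((1 - α) ^ k * gap)) := by rw [hϑ]; exact hmidu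
  have hle := sigmaOf_le (mΩ := mΩ) hZ
  obtain ⟨hfm, hfu, -⟩ := hend ϑ hmid' hϑs hϑu
  have hfin : P.real {ω | 2 * ((1 - α) ^ (k + 1) * gap) ≤ excess DX θs (θ (k + 1) ω)} ≤ δ := by
    simp only [hθK]
    exact (measureReal_two_mul_le (measurable_excess (hfm.mono (hle _) le_rfl)) hp
      (by positivity) hfu).trans hpδ
  have hθs (ω : Ω) : l0 (θ (k + 1) ω) ≤ s := by
    rw [hθK]
    exact (Finset.card_le_card (supp_exploitation_subset _ _ _ _ _)).trans (hϑs ω)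
  refine ⟨one_sub_le_measureReal (fun ω hω => ?_) hfin, fun hr =>
    ⟨one_sub_le_measureReal (fun ω hω => ?_) hfin, ?_⟩⟩
  · have : ¬ excess DX θs (θ (k + 1) ω) ≤ 2 * (1 - α) ^ (k + 1) * gap := hω
    show 2 * ((1 - α) ^ (k + 1) * gap) ≤ excess DX θs (θ (k + 1) ω)
    linarith
  · by_contra hlt
    exact hω (M.supp_subset (hθs ω) ((not_le.1 hlt).trans_le hr))
  -- run the exploitation from `θ_*` where the support has not been found
  obtain ⟨ψ, hψ⟩ : ∃ ψ : Ω → E d, ψ = fun ω => if supp θs ⊆ supp (ϑ ω) then ϑ ω else θs :=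
    ⟨_, rfl⟩
  have hψm : Measurable[sigmaOf Z (exploitedUntil (k + 1) 0)] ψ := by
    rw [hψ]
    exact @measurable_ite_subset_supp _ _ (sigmaOf Z (exploitedUntil (k + 1) 0)) _ hmid' θs
  have hψs (ω : Ω) : l0 (ψ ω) ≤ s := by
    rw [hψ]; simp only; split_ifs
    exacts [hϑs ω, M.l0_le]
  have hψsupp (ω : Ω) : supp θs ⊆ supp (ψ ω) := by
    rw [hψ]; simp only; split_ifs with h
    exacts [h, subset_rfl]
  have hψu : eLpNorm (fun ω => excess DX θs (ψ ω)) p P ≤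
      ENNReal.ofReal ((1 - 6 * α) * ((1 - α) ^ k * gap)) := by
    -- Replacing the start by `θs`, where the excess vanishes, only lowers the excess. Since the
    -- replacement depends on the past alone, the batches remain fresh.
    refine le_trans (eLpNorm_mono_real fun ω => ?_) hϑu
    rw [Real.norm_of_nonneg (M.excess_nonneg _), hψ]
    simp only
    split_ifs
    · exact le_rfl
    · simpa [excess] using M.excess_nonneg (ϑ ω)
  obtain ⟨hgm, -, hgu⟩ := hend ψ hψm hψs hψu
  have hbad₁ : P.real {ω | 2 * ((1 - α) ^ (k + 1) * gap) ≤ excess DX θs (ϑ ω)} ≤ δ := by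
    refine (measureReal_two_mul_le (measurable_excess (hmid'.mono (hle _) le_rfl)) hp
      (by positivity) (hϑu.trans (ENNReal.ofReal_le_ofReal ?_))).trans hpδ
    rw [pow_succ', mul_assoc]
    gcongr
    linarith
  have hbad₂ := (measureReal_two_mul_le (measurable_excess (hgm.mono (hle _) le_rfl)) hp
    (by positivity) (hgu hψsupp)).trans hpδ
  refine one_sub_le_measureReal (fun ω hω => ?_)
    ((measureReal_union_le _ _).trans (by linarith [hbad₁, hbad₂] :
      P.real {ω | 2 * ((1 - α) ^ (k + 1) * gap) ≤ excess DX θs (ϑ ω)} +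
      P.real {ω | 2 * ((1 - α) ^ (k + 1 + T) * gap) ≤ excess DX θs (exploitation (1 / 2 / L)
        (fun t => B t (k + 1)) (fun t b => Z (.exploit (k + 1) t b) ω) (ψ ω) T)} ≤ 2 * δ))
  by_contra hnot
  rw [Set.mem_union, not_or] at hnot
  have h1 : excess DX θs (ϑ ω) < 2 * ((1 - α) ^ (k + 1) * gap) := not_le.1 hnot.1
  have h2 : excess DX θs (exploitation (1 / 2 / L)
      (fun t => B t (k + 1)) (fun t b => Z (.exploit (k + 1) t b) ω) (ψ ω) T) <
      2 * ((1 - α) ^ (k + 1 + T) * gap) := not_le.1 hnot.2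
  have h3 : ψ ω = ϑ ω := by
    rw [hψ]; exact if_pos (M.supp_subset (hϑs ω) (h1.trans_le hr))
  rw [h3, ← hθK] at h2
  -- Exploitation may cancel a coordinate of its support, so the inclusion for the final iterate is
  -- derived anew from its own small excess.
  have h4 : 2 * ((1 - α) ^ (k + 1 + T) * gap) ≤ 2 * ((1 - α) ^ (k + 1) * gap) := by
    gcongr 2 * (?_ * _)
    exact pow_le_pow_of_le_one h1α.le (by linarith) (Nat.le_add_right _ _)
  refine hω ⟨M.supp_subset (hθs ω) (h2.trans_le (h4.trans hr)), ?_⟩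
  linarith

end SparseModel

/-! ### The identification threshold and the choice of constants -/

lemma rMin_pos {d : ℕ} {θ : E d} (hθ : θ ≠ 0) : 0 < rMin θ := by
  have hne : ((fun j => |θ j|) '' {j | θ j ≠ 0}).Nonempty := by
    by_contra h
    rw [Set.not_nonempty_iff_eq_empty, Set.image_eq_empty] at h
    refine hθ ?_
    ext j
    by_contra hj
    have : j ∈ {j | θ j ≠ 0} := hj
    rw [h] at this
    exact this
  obtain ⟨j, hj, hje⟩ := hne.csInf_mem (Set.toFinite _)
  rw [rMin, ← hje]
  exact abs_pos.2 hj

/-- Exponentiating the bound on `K` gives `4 gap / (r² μ) ≤ (1 - α)^{-K}`. The result is the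
smallness condition for support identification, including the factor `2` lost to Markov's
inequality. -/
lemma two_mul_pow_mul_le_of_identRounds_le {α gap r μ : ℝ} (hα0 : 0 < α) (hα1 : α < 1)
    (hgap : 0 < gap) (hr : 0 < r) (hμ : 0 < μ) {K : ℕ}
    (hK : identRounds α gap r μ ≤ (K : ℤ)) :
    2 * ((1 - α) ^ K * gap) ≤ μ / 2 * r ^ 2 := by
  have h1α : 0 < 1 - α := by linarith
  have hlog : 0 < Real.log (1 - α)⁻¹ := Real.log_pos ((one_lt_inv₀ h1α).2 (by linarith))
  have h1 : 1 / Real.log (1 - α)⁻¹ * Real.log (4 * gap / (r ^ 2 * μ)) ≤ K := by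
    exact_mod_cast Int.ceil_le.1 hK
  rw [one_div_mul_eq_div, div_le_iff₀ hlog, ← Real.log_pow,
    Real.log_le_log_iff (by positivity) (by positivity), inv_pow,
    div_le_iff₀ (by positivity)] at h1
  have h2 := mul_le_mul_of_nonneg_left h1 (by positivity : 0 ≤ (1 - α) ^ K)
  rw [mul_inv_cancel_left₀ (by positivity)] at h2
  linarith

end SparseHybrid

theorem theorem3 :
    -- universal constants
    ∃ cη : ℝ, 0 < cη ∧ ∃ cα : ℝ, 0 < cα ∧ cα < 1 ∧ ∃ Cs : ℝ, 0 < Cs ∧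
    ∀ cT : ℝ, 0 < cT → ∃ CB : ℝ, 0 < CB ∧
    -- the problem
    ∀ (d s s' : ℕ), 1 ≤ s → s < s' → s' ≤ d →
    ∀ (DX : Measure (E d)) [IsProbabilityMeasure DX] (N : Measure ℝ) [IsProbabilityMeasure N]
      (θs : E d) (R : ℝ) (σ : ℝ≥0) (L μ : ℝ),
    (∀ᵐ x ∂DX, ∀ j, |x j| ≤ R) →
    (∫ ξ, ξ ∂N) = 0 → HasSubgaussianMGF id (σ ^ 2) N →
    0 < L → RestrictedSmooth (risk (modelLaw DX N θs)) s L →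
    0 < μ → RestrictedStronglyConvex (risk (modelLaw DX N θs)) s μ →
    -- the parameters of the algorithm
    Cs * (L / μ) ^ 2 * l0 θs ≤ s →
    ∀ (H : E d → E d), IsHardThresholding s H →
    ∀ (θ₀ : E d) (η α gap₀ : ℝ) (Ttilde : ℕ),
    η = cη / L → α = cα / (L / μ) →
    gap₀ = risk (modelLaw DX N θs) (H θ₀) - risk (modelLaw DX N θs) θs → 0 < gap₀ →
    Ttilde = exploitSteps α (cT * (L / μ) ^ 2) d s' s →
    ∀ δ : ℝ, 0 < δ → δ < 1 / 3 →
    -- sufficient batch sizes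
    ∃ Bm₀ B₀ : ℕ → ℕ → ℕ,
      (∀ t k, 1 ≤ t → 1 ≤ k →
        (Bm₀ t k : ℝ) ≤ CB * Real.log (L / μ * d / δ) * batchScale L μ R σ gap₀ α s k 3) ∧
      (∀ t k, 1 ≤ t → 1 ≤ k →
        (B₀ t k : ℝ) ≤ CB * Real.log (L / μ * d / δ) * batchScale L μ R σ gap₀ α s k Ttilde) ∧
      ∀ (Bm B : ℕ → ℕ → ℕ), (∀ t k, Bm₀ t k ≤ Bm t k) → (∀ t k, B₀ t k ≤ B t k) →
      -- the examples: independent draws from the model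
      ∀ (Ω : Type*) [MeasurableSpace Ω] (P : Measure Ω) [IsProbabilityMeasure P]
        (Z : SampleIdx → Ω → E d × ℝ),
      (∀ i, Measurable (Z i)) → (∀ i, P.map (Z i) = modelLaw DX N θs) → iIndepFun Z P →
      ∀ (θ : ℕ → Ω → E d),
      (∀ k ω, θ k ω =
        hybrid H η s' s Bm B (fun _ => 3) (fun _ => Ttilde) (fun i => Z i ω) θ₀ k) →
      ∀ K : ℕ, 1 ≤ K →
        1 - δ ≤ P.real {ω | risk (modelLaw DX N θs) (θ K ω) - risk (modelLaw DX N θs) θs ≤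
          2 * (1 - α) ^ K * gap₀} ∧
        (θs ≠ 0 → identRounds α gap₀ (rMin θs) μ + 1 ≤ (K : ℤ) →
          1 - δ ≤ P.real {ω | supp θs ⊆ supp (θ K ω)} ∧
          1 - 2 * δ ≤ P.real {ω | supp θs ⊆ supp (θ K ω) ∧
            risk (modelLaw DX N θs) (θ K ω) - risk (modelLaw DX N θs) θs ≤
              2 * (1 - α) ^ (K + Ttilde) * gap₀}) := by
  refine ⟨1 / 2, by norm_num, 1 / 64, by norm_num, by norm_num, 96, by norm_num,
    fun cT hcT => ⟨10 ^ 8, by norm_num, ?_⟩⟩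
  intro d s s' hs hss' hs'd DX _ N _ θs R σ L μ hR hN hσ hL hLs hμ hμs hsparse H hH θ₀ η α gap₀ T
    hη hα hgap hgap0 hT δ hδ hδ3
  have hd : 2 ≤ d := by omega
  have hform := restrictedForm_covOp hR hN hσ hLs hμs
  have hμL := hform.le_of_one_le hs (by omega)
  have hR2 := hform.le_sq_bound hR hs (by omega)
  have M : SparseModel DX N θs R σ s L μ := ⟨hR, hσ, hs, hL, hμ, hμL, hform, hsparse⟩
  have hκ := M.one_le_kappa
  have hα0 : 0 < α := by rw [hα]; positivity
  have hα1 : α < 1 := by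
    rw [hα]; exact (div_le_self (by norm_num) hκ).trans_lt (by norm_num)
  have hexc (θ : E d) : risk (modelLaw DX N θs) θ - risk (modelLaw DX N θs) θs =
      excess DX θs θ := by
    rw [risk_eq hR hN hσ, risk_eq hR hN hσ, excess]; simp
  have hdR : (2 : ℝ) ≤ d := by exact_mod_cast hd
  obtain ⟨Λ, hΛ⟩ : ∃ Λ : ℝ, Λ = Real.log (L / μ * d / δ) := ⟨_, rfl⟩
  have harg : (d : ℝ) / δ ≤ L / μ * d / δ := by
    gcongr; exact le_mul_of_one_le_left (by positivity) hκ
  have hd1 : (d : ℝ) ≤ d / δ := le_div_self (by positivity) hδ (by linarith)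
  have hδ1 : 1 / δ ≤ d / δ := by gcongr; linarith
  have hpos : 0 < L / μ * d / δ := by positivity
  have hΛ1 : 1 ≤ Λ := by
    rw [hΛ, Real.le_log_iff_exp_le hpos]
    have h3 : 3 ≤ 1 / δ := by rw [le_div_iff₀ hδ]; linarith
    linarith [Real.exp_one_lt_d9]
  have hexpΛ : Real.exp Λ = L / μ * d / δ := by rw [hΛ, Real.exp_log hpos]
  -- The factor `2` serves the confidence level: `2^{-p} ≤ e^{-p/2} ≤ e^{-Λ} ≤ δ`. It also gives `d
  -- ≤ e^p`, and `Λ ≥ 1` keeps `p ≤ 3Λ` after rounding up.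
  obtain ⟨p, hpdef⟩ : ∃ p : ℕ, p = ⌈2 * Λ⌉₊ := ⟨_, rfl⟩
  have hp2 : 2 * Λ ≤ p := by rw [hpdef]; exact Nat.le_ceil _
  have hp3 : (p : ℝ) ≤ 3 * Λ := by
    rw [hpdef]
    have := Nat.ceil_lt_add_one (by linarith : 0 ≤ 2 * Λ)
    linarith
  have hp1 : 1 ≤ p := by
    have : (1 : ℝ) ≤ p := by linarith
    exact_mod_cast this
  have hdp : (d : ℝ) ≤ Real.exp p := by
    have h1 : Real.exp Λ ≤ Real.exp p := Real.exp_le_exp.2 (by linarith)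
    linarith
  have hpδ : (1 / 2 : ℝ) ^ p ≤ δ := by
    have h1 : (1 / 2 : ℝ) ≤ Real.exp (-(1 / 2)) := by
      have := Real.add_one_le_exp (-(1 / 2) : ℝ)
      linarith
    calc (1 / 2 : ℝ) ^ p ≤ Real.exp (-(1 / 2)) ^ p := by gcongr
      _ = Real.exp (-(p / 2)) := by rw [← Real.exp_nat_mul]; congr 1; ring
      _ ≤ Real.exp (-Λ) := Real.exp_le_exp.2 (by linarith)
      _ = (L / μ * d / δ)⁻¹ := by rw [Real.exp_neg, hexpΛ]
      _ ≤ (1 / δ)⁻¹ := inv_anti₀ (by positivity) (hδ1.trans harg)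
      _ = δ := by simp
  have hscale (k T : ℕ) : 0 ≤ batchScale L μ R σ gap₀ α s k T :=
    le_trans (by positivity) (le_max_left _ _)
  -- Rounding down makes the required upper bounds on the batch sizes immediate.
  refine ⟨fun _ k => ⌊(10 : ℝ) ^ 8 * Λ * batchScale L μ R σ gap₀ α s k 3⌋₊,
    fun _ k => ⌊(10 : ℝ) ^ 8 * Λ * batchScale L μ R σ gap₀ α s k T⌋₊, fun t k _ _ => ?_,
    fun t k _ _ => ?_, ?_⟩
  · rw [← hΛ]
    exact Nat.floor_le (mul_nonneg (by positivity) (hscale _ _))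
  · rw [← hΛ]
    exact Nat.floor_le (mul_nonneg (by positivity) (hscale _ _))
  intro Bm B hBm hB Ω _ P _ Z hZ hlaw hind θ hθ K hK
  rw [hη] at hθ
  obtain ⟨h1, h2⟩ := M.hybrid_bound hH hZ hlaw hind (δ := δ) (T := T) (s' := s')
    hα hgap0 hp1 hdp hpδ
    (fun k t ht => goodBatch_of_floor_le hL hμ hR2 hs hα hα1 hgap0 hΛ1 hp3 (by norm_num)
      (hBm (t + 1) (k + 1)))
    (fun k t ht => goodBatch_of_floor_le hL hμ hR2 hs hα hα1 hgap0 hΛ1 hp3 (by omega)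
      (hB (t + 1) (k + 1)))
    (by rw [hgap, hexc]) hθ hK
  simp only [hexc]
  exact ⟨h1, fun hθs hident => h2 (two_mul_pow_mul_le_of_identRounds_le hα0 hα1 hgap0
    (rMin_pos hθs) hμ (by omega))⟩
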